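/- Let $T>0$, $U\subseteq\mathbb R^m$, $A\subseteq\mathbb R^l$, $\tilde f:\mathbb R^n\times U\times A\to\mathbb R^n$, $\tilde g_\alpha:\mathbb R^n\times\mathbb R^m\to\mathbb R^n$ ($\alpha=1,\dots,m$), and put $g_\alpha=(\tilde g_\alpha,\mathbf e_\alpha)$, a vector field on $\mathbb R^{n+m}$. Consider the impulsive Cauchy problem $$\begin{pmatrix}\dot x\\ \dot z\end{pmatrix}=\begin{pmatrix}\tilde f(x,z,a)\\0\end{pmatrix}+\sum_{\alpha=1}^m\dot u^\alpha\,g_\alpha(x,z),\qquad (x,z)(0)=(x_0,u(0)).\qquad(\ast)$$ Standing assumptions. (1) The $g_\alpha$ are of class $C^2$ on $\mathbb R^{n+m}$, complete (all their integral curves are defined on $\mathbb R$), and commute: $[g_\alpha,g_\beta]=0$ for all $\alpha,\beta$. (2) $U$ is the closure of a connected open set and $A$ is compact. (3) On each compact subset of $\mathbb R^n\times U$, $\tilde f(\cdot,\cdot,a)$ is Lipschitz with a constant independent of $a\in A$; for every $(x,z)\in\mathbb R^n\times U$, $\tilde f(x,z,\cdot)$ is continuous on $A$; and there is $M>0$ with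 $|\tilde f(x,z,a)|\le M(1+|(x,z)|)$ on $\mathbb R^n\times U\times A$. (4) Bounded inputs give bounded states: for every $M$ there is $N$ such that every Carathéodory solution of $(\ast)$, on any interval $[0,\tau]\subseteq[0,T]$, driven by $u\in C^1([0,T],U)$ and $a\in L^1(0,T;A)$ with $|x_0|+\|u\|_\infty\le M$, satisfies $|x(t)|\le N$ on $[0,\tau]$. For $F\subseteq\mathbb R^d$, $L^1_{\{0\}}(0,T;F)$ is the set of $F$-valued integrable maps on $[0,T]$, two maps being identified when they coincide a.e. and at $t=0$; $y_k\to y$ in $L^1_{\{0\}}$ means $y_k\to y$ in $L^1(0,T)$ and $y_k(0)\to y(0)$. For $x_0\in\mathbb R^n$, $u\in L^1_{\{0\}}(0,T;U)$, $a\in L^1(0,T;A)$, a generalized solution of $(\ast)$ is a map $(\xi,\eta)\in L^1_{\{0\}}(0,T;\mathbb R^n\times U)$ for which there are controls $u_k\in C^1([0,T],U)$ and Carathéodory solutions $(x_k,z_k)$ on $[0,T]$ of $(\ast)$ with input $(x_0,u_k,a)$, such that the functions $(x_k,z_k)$ have values bounded uniformly in $k$ and $t$, $(x_k,z_k)\to(\xi,\eta)$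 in $L^1_{\{0\}}$, and $u_k\to u$ in $L^1_{\{0\}}$. Corollary. Let $x_0\in\mathbb R^n$, $a\in L^1(0,T;A)$ and $u\in L^1_{\{0\}}(0,T;U)$, and suppose that $u$ takes its values (at $t=0$ and at a.e. $t$) in the closure of some bounded connected open subset of $U$ (when $U$ is bounded this holds for every $u\in L^1_{\{0\}}(0,T;U)$; when $U$ is convex with non-empty interior, it holds for every essentially bounded $u$). Then there is a $\xi\in L^1_{\{0\}}(0,T;\mathbb R^n)$ such that $(\xi,u)$ is a generalized solution of $(\ast)$, and it is the only one: every generalized solution coincides with $(\xi,u)$ a.e. on $[0,T]$ and at $t=0$. -/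

import Mathlib

open Set Filter Topology MeasureTheory

namespace Impulsive

noncomputable section

/-- Integrable maps on `[0,T]`, pointwise defined on `I`, with values in `F` (on `I`, and almost
everywhere on `[0,T]`). The elements of `L¹_I(0,T;F)` are the classes of such maps modulo `EqI`. -/
def MemL1I {E : Type*} [NormedAddCommGroup E] (T : ℝ) (I : Set ℝ) (F : Set E) (y : ℝ → E) : Prop :=
  IntegrableOn y (Icc 0 T) volume ∧ (∀ t ∈ I, y t ∈ F) ∧
    ∀ᵐ t ∂(volume.restrict (Icc 0 T)), y t ∈ F

/-- `I`-equivalence: equality at every point of `I` and almost everywhere on `[0,T]`. -/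
def EqI {E : Type*} (T : ℝ) (I : Set ℝ) (y z : ℝ → E) : Prop :=
  (∀ t ∈ I, y t = z t) ∧ ∀ᵐ t ∂(volume.restrict (Icc 0 T)), y t = z t

/-- Convergence in `L¹_I`: convergence in `L¹(0,T)` and pointwise at every point of `I`. -/
def TendstoL1I {E : Type*} [NormedAddCommGroup E] (T : ℝ) (I : Set ℝ)
    (y : ℕ → ℝ → E) (y' : ℝ → E) : Prop :=
  Tendsto (fun k => eLpNorm (y k - y') 1 (volume.restrict (Icc 0 T))) atTop (𝓝 0) ∧
    ∀ t ∈ I, Tendsto (fun k => y k t) atTop (𝓝 (y' t))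

variable {n m l : ℕ}

/-- The augmented drift `(f̃, 0)` at the state `p = (x, z)`. -/
def drift
    (f : EuclideanSpace ℝ (Fin n) → EuclideanSpace ℝ (Fin m) → EuclideanSpace ℝ (Fin l) →
      EuclideanSpace ℝ (Fin n))
    (b : EuclideanSpace ℝ (Fin l)) (p : EuclideanSpace ℝ (Fin n) × EuclideanSpace ℝ (Fin m)) :
    EuclideanSpace ℝ (Fin n) × EuclideanSpace ℝ (Fin m) :=
  (f p.1 p.2 b, 0)

/-- The augmented vector field `g_α = (g̃_α, e_α)` at the state `p = (x, z)`. -/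
def field
    (g : Fin m → EuclideanSpace ℝ (Fin n) → EuclideanSpace ℝ (Fin m) → EuclideanSpace ℝ (Fin n))
    (α : Fin m) (p : EuclideanSpace ℝ (Fin n) × EuclideanSpace ℝ (Fin m)) :
    EuclideanSpace ℝ (Fin n) × EuclideanSpace ℝ (Fin m) :=
  (g α p.1 p.2, EuclideanSpace.single α 1)

/-- Controls of class `C¹` on `[0,T]` with values in `U`. -/
def IsC1Control (T : ℝ) (U : Set (EuclideanSpace ℝ (Fin m))) (v : ℝ → EuclideanSpace ℝ (Fin m)) :
    Prop :=
  ContDiffOn ℝ 1 v (Icc 0 T) ∧ MapsTo v (Icc 0 T) U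

/-- The right-hand side `(f̃, 0)(w, a) + ∑ α, v̇^α g_α(w)` along a curve `w = (x, z)`. -/
def rhs (T : ℝ)
    (f : EuclideanSpace ℝ (Fin n) → EuclideanSpace ℝ (Fin m) → EuclideanSpace ℝ (Fin l) →
      EuclideanSpace ℝ (Fin n))
    (g : Fin m → EuclideanSpace ℝ (Fin n) → EuclideanSpace ℝ (Fin m) → EuclideanSpace ℝ (Fin n))
    (v : ℝ → EuclideanSpace ℝ (Fin m)) (a : ℝ → EuclideanSpace ℝ (Fin l))
    (w : ℝ → EuclideanSpace ℝ (Fin n) × EuclideanSpace ℝ (Fin m)) (s : ℝ) :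
    EuclideanSpace ℝ (Fin n) × EuclideanSpace ℝ (Fin m) :=
  drift f (a s) (w s) + ∑ α : Fin m, (derivWithin v (Icc 0 T) s) α • field g α (w s)

/-- `w = (x, z)` is a (Carathéodory) solution on `[0,τ]`, `0 ≤ τ ≤ T`, of the augmented Cauchy
problem driven by the `C¹` control `v` and by `a`, with `(x, z)(0) = (x₀, v 0)`. -/
def IsSolution (T : ℝ)
    (f : EuclideanSpace ℝ (Fin n) → EuclideanSpace ℝ (Fin m) → EuclideanSpace ℝ (Fin l) →
      EuclideanSpace ℝ (Fin n))
    (g : Fin m → EuclideanSpace ℝ (Fin n) → EuclideanSpace ℝ (Fin m) → EuclideanSpace ℝ (Fin n))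
    (x₀ : EuclideanSpace ℝ (Fin n))
    (v : ℝ → EuclideanSpace ℝ (Fin m)) (a : ℝ → EuclideanSpace ℝ (Fin l)) (τ : ℝ)
    (w : ℝ → EuclideanSpace ℝ (Fin n) × EuclideanSpace ℝ (Fin m)) : Prop :=
  IntervalIntegrable (rhs T f g v a w) volume 0 τ ∧
    ∀ t ∈ Icc 0 τ, w t = (x₀, v 0) + ∫ s in (0 : ℝ)..t, rhs T f g v a w s

/-- Generalized solution `w = (x, z)`, pointwise defined on `I`, for the input `(x₀, u, a)`: the
limit in `L¹_I` of a uniformly bounded sequence of solutions driven by `C¹` controls which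
converge to `u` in `L¹_I`. -/
def IsGeneralizedSolution (T : ℝ) (I : Set ℝ) (U : Set (EuclideanSpace ℝ (Fin m)))
    (f : EuclideanSpace ℝ (Fin n) → EuclideanSpace ℝ (Fin m) → EuclideanSpace ℝ (Fin l) →
      EuclideanSpace ℝ (Fin n))
    (g : Fin m → EuclideanSpace ℝ (Fin n) → EuclideanSpace ℝ (Fin m) → EuclideanSpace ℝ (Fin n))
    (x₀ : EuclideanSpace ℝ (Fin n))
    (u : ℝ → EuclideanSpace ℝ (Fin m)) (a : ℝ → EuclideanSpace ℝ (Fin l))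
    (w : ℝ → EuclideanSpace ℝ (Fin n) × EuclideanSpace ℝ (Fin m)) : Prop :=
  MemL1I T I (univ ×ˢ U) w ∧
    ∃ (v : ℕ → ℝ → EuclideanSpace ℝ (Fin m))
      (W : ℕ → ℝ → EuclideanSpace ℝ (Fin n) × EuclideanSpace ℝ (Fin m)),
      (∀ k, IsC1Control T U (v k)) ∧
      (∀ k, IsSolution T f g x₀ (v k) a T (W k)) ∧
      (∃ C : ℝ, ∀ k, ∀ t ∈ Icc 0 T, ‖W k t‖ ≤ C) ∧
      TendstoL1I T I W w ∧ TendstoL1I T I v u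

/-- Bounded inputs give bounded states: for all `M` there is `N` such that every solution driven by
a `C¹` control, on whatever interval `[0,τ] ⊆ [0,T]` it is defined, satisfies `|x| ≤ N` as soon as
`|x₀| + |v| ≤ M`. (Existence of solutions is not part of this.) -/
def BoundedInputBoundedState (T : ℝ) (U : Set (EuclideanSpace ℝ (Fin m)))
    (A : Set (EuclideanSpace ℝ (Fin l)))
    (f : EuclideanSpace ℝ (Fin n) → EuclideanSpace ℝ (Fin m) → EuclideanSpace ℝ (Fin l) →
      EuclideanSpace ℝ (Fin n))
    (g : Fin m → EuclideanSpace ℝ (Fin n) → EuclideanSpace ℝ (Fin m) → EuclideanSpace ℝ (Fin n)) :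
    Prop :=
  ∀ M : ℝ, ∃ N : ℝ, ∀ (x₀ : EuclideanSpace ℝ (Fin n)) (v : ℝ → EuclideanSpace ℝ (Fin m))
    (a : ℝ → EuclideanSpace ℝ (Fin l)) (τ : ℝ)
    (w : ℝ → EuclideanSpace ℝ (Fin n) × EuclideanSpace ℝ (Fin m)),
    IsC1Control T U v → MemL1I T ∅ A a → τ ∈ Icc 0 T →
    (∀ t ∈ Icc 0 T, ‖x₀‖ + ‖v t‖ ≤ M) →
    IsSolution T f g x₀ v a τ w → ∀ t ∈ Icc 0 τ, ‖(w t).1‖ ≤ N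

end

end Impulsive

-- The control derivative can be removed by a change of coordinates. The fields `g_α` commute and
-- are complete, and their `z`-components are the constant vectors `e_α`. Flowing back along `g_1,
-- …, g_m` for the times `z^1, …, z^m` therefore sends `(x, z)` to a point `(P(x, z), 0)`. The map
-- `(x, z) ↦ (P(x, z), z)` is a diffeomorphism of class `C²`, with inverse `Ψ`, and `DP · g_α = 0`
-- (`exists_isRectification`). Along a solution, `y = P(x, z)` then satisfies `y' = DP(Ψ(y, u)) ·
-- (f(Ψ(y, u), a), 0)` with `y(0) = P(x₀, u(0))`. No derivative of `u` occurs, so the equation makes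
-- sense for `u` merely measurable and bounded.
--
-- Since `P` and `Ψ` are `C²`, the reduced right-hand side is Lipschitz in `(y, u)` on bounded sets,
-- uniformly in `a`. Grönwall's inequality then bounds `y₁ - y₂` uniformly on `[0,T]` by a multiple
-- of the distance between the inputs in `L¹_{0}`; the value at `0` enters through the initial state
-- (`exists_norm_sub_le_of_isReducedSolution`). Consequently the limit of any bounded sequence of
-- solutions is `Ψ(y, u)`, where `y` solves the reduced equation for `u`. This is uniqueness
-- (`eqI_of_isGeneralizedSolution`).
--
-- For existence, `u` is approximated by `C¹` controls with values in the bounded open set `Ω₀`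
-- (`exists_contDiff_tendstoL1I`). The reduced equation, truncated so as to be globally Lipschitz,
-- is solved by Picard iteration. The bounded-input assumption bounds the solutions for the `C¹`
-- controls by a common constant, below the truncation level (`exists_bound_isReducedSolution`). The
-- bound passes to the limit, so the limit solves the equation without truncation.

local notation "ℝ^[" k "]" => EuclideanSpace ℝ (Fin k)

namespace Impulsive

/-! ### Carathéodory equations that are globally Lipschitz in the state. -/

section Caratheodory

theorem _root_.MeasureTheory.IntegrableOn.intervalIntegrable_zero {E : Type*}
    [NormedAddCommGroup E] {f : ℝ → E} {T t : ℝ}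
    (hf : IntegrableOn f (Icc 0 T)) (ht : t ∈ Icc 0 T) : IntervalIntegrable f volume 0 t := by
  rw [intervalIntegrable_iff_integrableOn_Icc_of_le ht.1]
  exact hf.mono_set (Icc_subset_Icc_right ht.2)

variable {E : Type*} [NormedAddCommGroup E] [NormedSpace ℝ E]

/-- Existence of Carathéodory solutions for a right-hand side which is globally Lipschitz in the
state, for almost every time. -/
theorem exists_caratheodory_solution [CompleteSpace E] {T : ℝ} (hT : 0 ≤ T) {F : ℝ → E → E}
    {L : ℝ} (hL : 0 ≤ L)
    (hLip : ∀ᵐ t ∂(volume.restrict (Icc 0 T)), ∀ y y', ‖F t y - F t y'‖ ≤ L * ‖y - y'‖)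
    (hint : ∀ y : ℝ → E, Continuous y → IntegrableOn (fun t => F t (y t)) (Icc 0 T)) (y₀ : E) :
    ∃ y : ℝ → E, Continuous y ∧ ∀ t ∈ Icc 0 T, y t = y₀ + ∫ s in (0 : ℝ)..t, F s (y s) := by
  -- The fixed point is sought in the complete space `C([0,T], E)`; curves are extended by constants
  -- so that `hint` applies to them.
  have hext : ∀ y : C(Icc 0 T, E), Continuous fun s : ℝ => y (projIcc 0 T hT s) := fun y =>
    y.continuous.comp continuous_projIcc
  let G : C(Icc 0 T, E) → C(Icc 0 T, E) := fun y =>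
    { toFun := fun t => y₀ + ∫ s in (0 : ℝ)..t, F s (y (projIcc 0 T hT s))
      continuous_toFun := by
        have h := intervalIntegral.continuousOn_primitive_interval (a := 0) (b := T) (μ := volume)
          (f := fun s => F s (y (projIcc 0 T hT s)))
          (by rw [uIcc_of_le hT]; exact hint _ (hext y))
        rw [uIcc_of_le hT] at h
        exact continuous_const.add (continuousOn_iff_continuous_domRestrict.1 h) }
  have hG : ∀ (y : C(Icc 0 T, E)) (t : Icc 0 T),
      G y t = y₀ + ∫ s in (0 : ℝ)..t, F s (y (projIcc 0 T hT s)) := fun _ _ => rfl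
  -- Picard's operator need not be a contraction, but the factorial gain makes some iterate one,
  -- without any restriction on `L * T`.
  have key : ∀ (k : ℕ) (y y' : C(Icc 0 T, E)) (t : Icc 0 T),
      ‖G^[k] y t - G^[k] y' t‖ ≤ (L * t) ^ k / k.factorial * dist y y' := by
    intro k
    induction k with
    | zero =>
      intro y y' t
      simpa [dist_eq_norm] using ContinuousMap.dist_apply_le_dist (f := y) (g := y') t
    | succ k ih =>
      intro y y' t
      rw [Function.iterate_succ_apply', Function.iterate_succ_apply', hG, hG,
        add_sub_add_left_eq_sub,
        ← intervalIntegral.integral_sub ((hint _ (hext _)).intervalIntegrable_zero t.2)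
          ((hint _ (hext _)).intervalIntegrable_zero t.2)]
      have h1 : ‖∫ s in (0 : ℝ)..t, (F s (G^[k] y (projIcc 0 T hT s)) -
          F s (G^[k] y' (projIcc 0 T hT s)))‖ ≤
          ∫ s in (0 : ℝ)..t, L * ((L * s) ^ k / k.factorial * dist y y') := by
        refine intervalIntegral.norm_integral_le_of_norm_le t.2.1 ?_
          (Continuous.intervalIntegrable (by fun_prop) _ _)
        filter_upwards [(ae_restrict_iff' measurableSet_Icc).1 hLip] with s hs hst
        have hsT : s ∈ Icc 0 T := ⟨hst.1.le, hst.2.trans t.2.2⟩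
        refine (hs hsT _ _).trans (mul_le_mul_of_nonneg_left ?_ hL)
        have := ih y y' (projIcc 0 T hT s)
        rwa [projIcc_of_mem hT hsT] at this ⊢
      refine h1.trans (le_of_eq ?_)
      have h2 : ∀ s : ℝ, L * ((L * s) ^ k / k.factorial * dist y y') =
          (L ^ (k + 1) / k.factorial * dist y y') * s ^ k := by
        intro s; rw [mul_pow]; ring
      simp_rw [h2]
      rw [intervalIntegral.integral_const_mul, integral_pow, Nat.factorial_succ]
      push_cast
      have : (k.factorial : ℝ) ≠ 0 := by positivity
      have : (k : ℝ) + 1 ≠ 0 := by positivity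
      simp only [ne_eq, Nat.add_eq_zero_iff, one_ne_zero, and_false, not_false_eq_true, zero_pow,
        sub_zero]
      field_simp
      rw [mul_pow]
      ring
  obtain ⟨k, hk⟩ : ∃ k : ℕ, (L * T) ^ k / k.factorial < 1 :=
    ((FloorSemiring.tendsto_pow_div_factorial_atTop (L * T)).eventually_lt_const one_pos).exists
  have hk0 : 0 ≤ (L * T) ^ k / k.factorial := by positivity
  have hcontr : ContractingWith ((L * T) ^ k / k.factorial).toNNReal G^[k] := by
    refine ⟨by rwa [Real.toNNReal_lt_one], LipschitzWith.of_dist_le_mul fun y y' => ?_⟩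
    rw [ContinuousMap.dist_le (by positivity)]
    intro t
    rw [dist_eq_norm]
    refine (key k y y' t).trans ?_
    have h0 : 0 ≤ L * t := mul_nonneg hL t.2.1
    have h1 : L * t ≤ L * T := mul_le_mul_of_nonneg_left t.2.2 hL
    rw [Real.coe_toNNReal _ hk0]
    gcongr
  -- The fixed point of a contracting iterate is fixed by `G` itself.
  have hfix := ContractingWith.isFixedPt_fixedPoint_iterate hcontr
  set y := hcontr.fixedPoint
  refine ⟨fun s => y (projIcc 0 T hT s), hext y, fun t ht => ?_⟩
  have h3 := congrArg (fun w : C(Icc 0 T, E) => w ⟨t, ht⟩) hfix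
  simp only [hG] at h3
  simp only [projIcc_of_mem hT ht]
  exact h3.symm

end Caratheodory

/-! ### Differentiability of integral curves in the initial state. -/

section Flow

variable {E : Type*} [NormedAddCommGroup E] [NormedSpace ℝ E]

theorem gronwallBound_zero_left (K ε x : ℝ) :
    gronwallBound 0 K ε x = ε * gronwallBound 0 K 1 x := by
  unfold gronwallBound
  split_ifs <;> ring

/-- Grönwall's inequality on `[0,1]` for a curve starting at the origin. -/
theorem norm_le_of_norm_deriv_le {e e' : ℝ → E} {K ε : ℝ} (hK : 0 ≤ K) (hε : 0 ≤ ε)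
    (he : ∀ t ∈ Icc (0 : ℝ) 1, HasDerivWithinAt e (e' t) (Icc 0 1) t) (h0 : e 0 = 0)
    (hb : ∀ t ∈ Icc (0 : ℝ) 1, ‖e' t‖ ≤ K * ‖e t‖ + ε) :
    ∀ t ∈ Icc (0 : ℝ) 1, ‖e t‖ ≤ ε * gronwallBound 0 K 1 1 := by
  intro t ht
  have h := norm_le_gronwallBound_of_norm_deriv_right_le (f := e) (f' := e') (δ := 0) (K := K)
    (ε := ε) (a := 0) (b := 1) (fun t ht => (he t ht).continuousWithinAt)
    (fun t ht => ((he t (Ico_subset_Icc_self ht)).mono_of_mem_nhdsWithin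
      (Icc_mem_nhdsGE_of_mem ht))) (by simp [h0])
    (fun t ht => hb t (Ico_subset_Icc_self ht)) t ht
  rw [sub_zero] at h
  rw [← gronwallBound_zero_left]
  exact h.trans (gronwallBound_mono le_rfl hε hK ht.2)

/-- Linear differential equations with continuous coefficients have solutions. -/
theorem exists_linear_solution [CompleteSpace E] {A : ℝ → E →L[ℝ] E}
    (hA : ContinuousOn A (Icc 0 1)) :
    ∃ Y : ℝ → E →L[ℝ] E, Y 0 = ContinuousLinearMap.id ℝ E ∧
      ∀ t ∈ Icc (0 : ℝ) 1, HasDerivWithinAt Y (A t ∘L Y t) (Icc 0 1) t := by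
  obtain ⟨L, hL⟩ := isCompact_Icc.exists_bound_of_continuousOn hA
  have hL0 : 0 ≤ L := (norm_nonneg _).trans (hL 0 (by simp))
  have hcont : ∀ Y : ℝ → E →L[ℝ] E, Continuous Y → ContinuousOn (fun t => A t ∘L Y t) (Icc 0 1) :=
    fun Y hY => hA.clm_comp hY.continuousOn
  obtain ⟨Y, hYc, hY⟩ := exists_caratheodory_solution (T := 1) zero_le_one
    (F := fun t (B : E →L[ℝ] E) => A t ∘L B) hL0
    (by
      refine (ae_restrict_iff' measurableSet_Icc).2 (ae_of_all _ fun t ht B B' => ?_)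
      rw [← ContinuousLinearMap.comp_sub]
      exact (ContinuousLinearMap.opNorm_comp_le _ _).trans
        (mul_le_mul_of_nonneg_right (hL t ht) (norm_nonneg _)))
    (fun Y hY => (hcont Y hY).integrableOn_Icc) (ContinuousLinearMap.id ℝ E)
  refine ⟨Y, by simpa using hY 0 (by simp), fun t ht => ?_⟩
  have hd : HasDerivWithinAt (fun u => ∫ s in (0 : ℝ)..u, A s ∘L Y s) (A t ∘L Y t) (Icc 0 1) t := by
    have : Fact (t ∈ Icc (0 : ℝ) 1) := ⟨ht⟩
    refine intervalIntegral.integral_hasDerivWithinAt_right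
      ((hcont Y hYc).integrableOn_Icc.intervalIntegrable_zero ht)
      ((hcont Y hYc).stronglyMeasurableAtFilter_nhdsWithin measurableSet_Icc t) (hcont Y hYc t ht)
  exact (hd.const_add _).congr hY (hY t ht)

/-- The curves `t ↦ φ p t`, `t ∈ [0,1]`, are integral curves of `X` with `φ p 0 = p`. -/
def IsUnitFlow (X : E → E) (φ : E → ℝ → E) : Prop :=
  ∀ p, φ p 0 = p ∧ ∀ t ∈ Icc (0 : ℝ) 1, HasDerivWithinAt (φ p) (X (φ p t)) (Icc 0 1) t

theorem IsUnitFlow.continuousOn {X : E → E} {φ : E → ℝ → E} (h : IsUnitFlow X φ) (p : E) :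
    ContinuousOn (φ p) (Icc 0 1) := fun t ht => ((h p).2 t ht).continuousWithinAt

/-- Integral curves depend in a Lipschitz way on the initial state, near a given one. -/
theorem IsUnitFlow.exists_lipschitz [FiniteDimensional ℝ E] {X : E → E} {φ : E → ℝ → E}
    (h : IsUnitFlow X φ) (hX : ContDiff ℝ 1 X) (p₀ : E) :
    ∃ r > 0, ∃ C ≥ 0, ∃ R, (∀ p ∈ Metric.ball p₀ r, ∀ t ∈ Icc (0 : ℝ) 1, ‖φ p t‖ ≤ R) ∧
      ∀ p ∈ Metric.ball p₀ r, ∀ q ∈ Metric.ball p₀ r, ∀ t ∈ Icc (0 : ℝ) 1,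
        ‖φ p t - φ q t‖ ≤ C * ‖p - q‖ := by
  obtain ⟨R, hR⟩ := isCompact_Icc.exists_bound_of_continuousOn (h.continuousOn p₀)
  obtain ⟨L, hL⟩ := hX.contDiffOn.exists_lipschitzOnWith (s := Metric.closedBall 0 (R + 1))
    one_ne_zero (convex_closedBall _ _) (isCompact_closedBall _ _)
  -- The Lipschitz constant of `X` is available only in the ball of radius `R + 1`, so this estimate
  -- is conditional on both curves staying there up to `τ`.
  have gron : ∀ p q τ, τ ∈ Icc (0 : ℝ) 1 → (∀ t ∈ Icc 0 τ, ‖φ p t‖ ≤ R + 1) →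
      (∀ t ∈ Icc 0 τ, ‖φ q t‖ ≤ R + 1) → ∀ t ∈ Icc 0 τ,
      ‖φ p t - φ q t‖ ≤ Real.exp L * ‖p - q‖ := by
    intro p q τ hτ hp hq t ht
    have hsub : Icc 0 τ ⊆ Icc (0 : ℝ) 1 := Icc_subset_Icc_right hτ.2
    have hd : ∀ p, ∀ t ∈ Ico 0 τ, HasDerivWithinAt (φ p) (X (φ p t)) (Ici t) t := fun p t ht =>
      ((h p).2 t (hsub (Ico_subset_Icc_self ht))).mono_of_mem_nhdsWithin
        (Icc_mem_nhdsGE_of_mem ⟨ht.1, ht.2.trans_le hτ.2⟩)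
    have := dist_le_of_trajectories_ODE_of_mem (v := fun _ => X) (K := L)
      (s := fun _ => Metric.closedBall 0 (R + 1)) (f := φ p) (g := φ q) (a := 0) (b := τ)
      (δ := ‖p - q‖) (fun _ _ => hL)
      ((h.continuousOn p).mono hsub) (hd p)
      (fun t ht => by simpa using hp t (Ico_subset_Icc_self ht))
      ((h.continuousOn q).mono hsub) (hd q)
      (fun t ht => by simpa using hq t (Ico_subset_Icc_self ht))
      (by rw [(h p).1, (h q).1, dist_eq_norm]) t ht
    rw [dist_eq_norm, sub_zero, mul_comm] at this
    refine this.trans (mul_le_mul_of_nonneg_right (Real.exp_le_exp.2 ?_) (norm_nonneg _))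
    have : t ≤ 1 := ht.2.trans hτ.2
    nlinarith [L.coe_nonneg]
  -- First-exit argument: at the first time `τ` at which the two curves are at distance `1`, the
  -- estimate `gron` on `[0, τ]` gives a distance smaller than `1`.
  have hbd : ∀ p ∈ Metric.ball p₀ (Real.exp L)⁻¹, ∀ t ∈ Icc (0 : ℝ) 1, ‖φ p t‖ ≤ R + 1 := by
    intro p hp
    by_contra! hcon
    obtain ⟨t₁, ht₁, hlt⟩ := hcon
    have hcont : ContinuousOn (fun t => ‖φ p t - φ p₀ t‖) (Icc 0 1) :=
      ((h.continuousOn p).sub (h.continuousOn p₀)).norm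
    have hp' : Real.exp L * ‖p - p₀‖ < 1 := by
      rw [mem_ball_iff_norm, ← one_div, lt_div_iff₀ (Real.exp_pos _)] at hp
      linarith
    have hclosed : IsCompact (Icc (0 : ℝ) 1 ∩ (fun t => ‖φ p t - φ p₀ t‖) ⁻¹' Ici 1) :=
      isCompact_Icc.of_isClosed_subset (hcont.preimage_isClosed_of_isClosed isClosed_Icc
        isClosed_Ici) inter_subset_left
    have hne : (Icc (0 : ℝ) 1 ∩ (fun t => ‖φ p t - φ p₀ t‖) ⁻¹' Ici 1).Nonempty := by
      refine ⟨t₁, ht₁, ?_⟩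
      simp only [mem_preimage, mem_Ici]
      have := norm_sub_norm_le (φ p t₁) (φ p₀ t₁)
      linarith [hR t₁ ht₁]
    obtain ⟨τ, ⟨hτ, hτ1⟩, hmin⟩ := hclosed.exists_isLeast hne
    have hbefore : ∀ t ∈ Ico 0 τ, ‖φ p t - φ p₀ t‖ < 1 := by
      intro t ht
      by_contra! hc
      exact absurd (hmin ⟨⟨ht.1, ht.2.le.trans hτ.2⟩, hc⟩) (not_le.2 ht.2)
    simp only [mem_preimage, mem_Ici] at hτ1
    have hτpos : 0 < τ := by
      rcases hτ.1.lt_or_eq with h' | h'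
      · exact h'
      · rw [← h', (h p).1, (h p₀).1] at hτ1
        have := Real.one_le_exp L.coe_nonneg
        nlinarith
    have hle : ∀ t ∈ Icc 0 τ, ‖φ p t - φ p₀ t‖ ≤ 1 := by
      have hsub : Icc 0 τ ⊆ Icc (0 : ℝ) 1 := Icc_subset_Icc_right hτ.2
      intro t ht
      refine ContinuousWithinAt.closure_le (s := Ico 0 τ) (g := fun _ => (1 : ℝ)) ?_
        ((hcont t (hsub ht)).mono (Ico_subset_Icc_self.trans hsub)) continuousWithinAt_const
        (fun y hy => (hbefore y hy).le)
      rwa [closure_Ico hτpos.ne]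
    have hb : ∀ t ∈ Icc 0 τ, ‖φ p t‖ ≤ R + 1 := by
      intro t ht
      have := norm_sub_norm_le (φ p t) (φ p₀ t)
      linarith [hle t ht, hR t ⟨ht.1, ht.2.trans hτ.2⟩]
    have := gron p p₀ τ hτ hb
      (fun t ht => (hR t ⟨ht.1, ht.2.trans hτ.2⟩).trans (by linarith)) τ ⟨hτ.1, le_rfl⟩
    linarith
  refine ⟨(Real.exp L)⁻¹, by positivity, Real.exp L, by positivity, R + 1, hbd, ?_⟩
  intro p hp q hq t ht
  exact gron p q 1 (by simp) (hbd p hp) (hbd q hq) t ht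

/-- The flow is strictly differentiable in the initial state; the derivative solves the
variational equation. -/
theorem IsUnitFlow.exists_hasStrictFDerivAt [FiniteDimensional ℝ E] {X : E → E} {φ : E → ℝ → E}
    (h : IsUnitFlow X φ) (hX : ContDiff ℝ 1 X) (p₀ : E) :
    ∃ Y : ℝ → E →L[ℝ] E, Y 0 = ContinuousLinearMap.id ℝ E ∧
      (∀ t ∈ Icc (0 : ℝ) 1, HasDerivWithinAt Y (fderiv ℝ X (φ p₀ t) ∘L Y t) (Icc 0 1) t) ∧
      ∀ t ∈ Icc (0 : ℝ) 1, HasStrictFDerivAt (fun p => φ p t) (Y t) p₀ := by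
  have : CompleteSpace E := FiniteDimensional.complete ℝ E
  have hDX : Continuous (fderiv ℝ X) := hX.continuous_fderiv one_ne_zero
  have hA : ContinuousOn (fun t => fderiv ℝ X (φ p₀ t)) (Icc 0 1) :=
    hDX.comp_continuousOn (h.continuousOn p₀)
  obtain ⟨Y, hY0, hY⟩ := exists_linear_solution hA
  refine ⟨Y, hY0, hY, fun t₀ ht₀ => ?_⟩
  obtain ⟨K, hK⟩ := isCompact_Icc.exists_bound_of_continuousOn hA
  have hK0 : 0 ≤ K := (norm_nonneg _).trans (hK 0 (by simp))
  obtain ⟨r, hr, C, hC, R, hR, hlip⟩ := h.exists_lipschitz hX p₀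
  set B := gronwallBound 0 K 1 1 with hB
  have hB0 : 0 ≤ B := by
    have := gronwallBound_mono (δ := 0) (ε := 1) le_rfl zero_le_one hK0 zero_le_one
    rwa [gronwallBound_x0] at this
  refine HasStrictFDerivAt.of_isLittleO (Asymptotics.isLittleO_iff.2 fun c hc => ?_)
  have hCB : 0 < C * B + 1 := by positivity
  -- The final error is `ε * C * B * ‖p - q‖`, which this choice keeps below `c * ‖p - q‖`; the `+
  -- 1` avoids dividing by zero.
  set ε := c / (C * B + 1) with hε
  have hε0 : 0 < ε := by positivity
  obtain ⟨δ, hδ, hunif⟩ := Metric.uniformContinuousOn_iff.1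
    ((isCompact_closedBall (0 : E) R).uniformContinuousOn_of_continuous hDX.continuousOn) ε hε0
  have hnear : ∀ᶠ p in 𝓝 p₀, p ∈ Metric.ball p₀ r ∧ C * ‖p - p₀‖ < δ := by
    refine Filter.Eventually.and (Metric.ball_mem_nhds p₀ hr) ?_
    have : Tendsto (fun p => C * ‖p - p₀‖) (𝓝 p₀) (𝓝 (C * ‖p₀ - p₀‖)) :=
      Continuous.tendsto (by fun_prop) _
    exact this.eventually_lt_const (by simpa using hδ)
  rw [nhds_prod_eq]
  filter_upwards [hnear.prod_mk hnear] with ⟨p, q⟩ ⟨⟨hp, hp'⟩, ⟨hq, hq'⟩⟩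
  simp only at hp hp' hq hq' ⊢
  have hp₀ : p₀ ∈ Metric.ball p₀ r := Metric.mem_ball_self hr
  -- The error `φ p t - φ q t - Y t (p - q)` solves the variational equation up to the Taylor
  -- remainder of `X`. Both `p` and `q` move, as strictness of the derivative requires.
  have hmain := norm_le_of_norm_deriv_le (e := fun t => φ p t - φ q t - Y t (p - q))
    (e' := fun t => X (φ p t) - X (φ q t) - fderiv ℝ X (φ p₀ t) (Y t (p - q))) (K := K)
    (ε := ε * (C * ‖p - q‖)) hK0 (by positivity)
    (fun t ht => (((h p).2 t ht).sub ((h q).2 t ht)).sub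
      ((hY t ht).clm_apply (hasDerivWithinAt_const t _ (p - q)) |>.congr_deriv (by simp)))
    (by simp [(h p).1, (h q).1, hY0]) ?_ t₀ ht₀
  · refine hmain.trans ?_
    have : ε * (C * ‖p - q‖) * B = ε * (C * B) * ‖p - q‖ := by ring
    rw [this]
    refine mul_le_mul_of_nonneg_right ?_ (norm_nonneg _)
    have : ε * (C * B + 1) = c := by rw [hε]; field_simp
    nlinarith
  · intro t ht
    have hmv : ‖X (φ p t) - X (φ q t) - fderiv ℝ X (φ p₀ t) (φ p t - φ q t)‖ ≤
        ε * ‖φ p t - φ q t‖ := by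
      refine ((convex_ball (φ p₀ t) δ).inter
        (convex_closedBall (0 : E) R)).norm_image_sub_le_of_norm_hasFDerivWithin_le'
        (fun z _ => ((hX.differentiable one_ne_zero z).hasFDerivAt).hasFDerivWithinAt)
        (fun z hz => ?_) ?_ ?_
      · have := hunif z hz.2 (φ p₀ t) (by simpa using hR p₀ hp₀ t ht) hz.1
        rw [dist_eq_norm] at this
        exact this.le
      · exact ⟨by rw [mem_ball_iff_norm]; exact (hlip q hq p₀ hp₀ t ht).trans_lt hq',
          by simpa using hR q hq t ht⟩
      · exact ⟨by rw [mem_ball_iff_norm]; exact (hlip p hp p₀ hp₀ t ht).trans_lt hp',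
          by simpa using hR p hp t ht⟩
    have hsplit : X (φ p t) - X (φ q t) - fderiv ℝ X (φ p₀ t) (Y t (p - q)) =
        fderiv ℝ X (φ p₀ t) (φ p t - φ q t - Y t (p - q)) +
          (X (φ p t) - X (φ q t) - fderiv ℝ X (φ p₀ t) (φ p t - φ q t)) := by
      simp only [map_sub]; abel
    rw [hsplit]
    refine (norm_add_le _ _).trans (add_le_add ?_ (hmv.trans ?_))
    · exact (ContinuousLinearMap.le_opNorm _ _).trans
        (mul_le_mul_of_nonneg_right (hK t ht) (norm_nonneg _))
    · exact mul_le_mul_of_nonneg_left (hlip p hp q hq t ht) hε0.le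

/-- Strict differentiability at `p₀` makes `f - f' p₀` Lipschitz with a small constant near `p₀`,
and this constant bounds `f' p - f' p₀` for `p` near `p₀`. Continuity of the derivative is thus
automatic. -/
theorem contDiff_one_of_hasStrictFDerivAt {F : Type*} [NormedAddCommGroup F] [NormedSpace ℝ F]
    {f : E → F} {f' : E → E →L[ℝ] F} (h : ∀ p, HasStrictFDerivAt f (f' p) p) :
    ContDiff ℝ 1 f := by
  refine contDiff_one_iff_hasFDerivAt.2 ⟨f', ?_, fun p => (h p).hasFDerivAt⟩
  refine continuous_iff_continuousAt.2 fun p₀ => Metric.continuousAt_iff'.2 fun ε hε => ?_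
  have hc : (0 : ℝ) < ε / 2 := by positivity
  obtain ⟨s, hs, hlip⟩ := (h p₀).approximates_deriv_on_nhds (c := (ε / 2).toNNReal)
    (Or.inr (by simpa using hc))
  filter_upwards [eventually_mem_nhds_iff.2 hs] with p hp
  rw [dist_eq_norm]
  have hd : HasFDerivAt (fun q => f q - f' p₀ q) (f' p - f' p₀) p :=
    (h p).hasFDerivAt.sub (f' p₀).hasFDerivAt
  have := hd.le_of_lipschitzOn hp (C := (ε / 2).toNNReal)
    (ApproximatesLinearOn.approximatesLinearOn_iff_lipschitzOnWith.1 hlip)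
  rw [Real.coe_toNNReal _ hc.le] at this
  linarith

theorem IsUnitFlow.contDiff_one [FiniteDimensional ℝ E] {X : E → E} {φ : E → ℝ → E}
    (h : IsUnitFlow X φ) (hX : ContDiff ℝ 1 X) : ContDiff ℝ 1 fun p => φ p 1 := by
  choose Y _ _ hY using h.exists_hasStrictFDerivAt hX
  exact contDiff_one_of_hasStrictFDerivAt fun p => hY p 1 (by simp)

/-- The time-one map of a field of class `C²` is of class `C²`. -/
theorem IsUnitFlow.contDiff_two [FiniteDimensional ℝ E] {X : E → E} {φ : E → ℝ → E}
    (h : IsUnitFlow X φ) (hX : ContDiff ℝ 2 X) : ContDiff ℝ 2 fun p => φ p 1 := by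
  have hX1 : ContDiff ℝ 1 X := hX.of_le one_le_two
  choose Y hY0 hYd hY using h.exists_hasStrictFDerivAt hX1
  have hDX : ContDiff ℝ 1 (fderiv ℝ X) := hX.fderiv_right (by norm_num)
  -- The derivative of the flow is part of the flow of the prolonged field `(X, DX · v)`, which is
  -- `C¹`. The `C¹` result applied to it gives one more derivative.
  have hprol : IsUnitFlow (E := E × E) (fun p => (X p.1, fderiv ℝ X p.1 p.2))
      (fun p t => (φ p.1 t, Y p.1 t p.2)) := by
    intro p
    refine ⟨by simp [(h p.1).1, hY0], fun t ht => ((h p.1).2 t ht).prodMk ?_⟩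
    exact ((hYd p.1 t ht).clm_apply (hasDerivWithinAt_const t _ p.2)).congr_deriv (by simp)
  have hC : ContDiff ℝ 1 fun p : E × E => (φ p.1 1, Y p.1 1 p.2) :=
    hprol.contDiff_one (by fun_prop)
  have hfd : fderiv ℝ (fun p => φ p 1) = fun p => Y p 1 :=
    funext fun p => (hY p 1 (by simp)).hasFDerivAt.fderiv
  rw [show (2 : WithTop ℕ∞) = 1 + 1 by norm_num, contDiff_succ_iff_fderiv]
  refine ⟨(h.contDiff_one hX1).differentiable one_ne_zero, by simp, ?_⟩
  rw [hfd, contDiff_clm_apply_iff]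
  intro v
  exact (contDiff_snd.comp hC).comp (contDiff_id.prodMk contDiff_const)

/-- A field which commutes with `X` is invariant under the time-one map of `X`. -/
theorem IsUnitFlow.fderiv_apply_of_lieBracket_eq_zero [FiniteDimensional ℝ E] {X G : E → E}
    {φ : E → ℝ → E} (h : IsUnitFlow X φ) (hX : ContDiff ℝ 1 X) (hG : ContDiff ℝ 1 G)
    (hcomm : ∀ p, VectorField.lieBracket ℝ X G p = 0) (p : E) :
    fderiv ℝ (fun q => φ q 1) p (G p) = G (φ p 1) := by
  obtain ⟨Y, hY0, hYd, hY⟩ := h.exists_hasStrictFDerivAt hX p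
  rw [(hY 1 (by simp)).hasFDerivAt.fderiv]
  have hA : ContinuousOn (fun t => fderiv ℝ X (φ p t)) (Icc 0 1) :=
    (hX.continuous_fderiv one_ne_zero).comp_continuousOn (h.continuousOn p)
  obtain ⟨K, hK⟩ := isCompact_Icc.exists_bound_of_continuousOn hA
  have hK0 : 0 ≤ K := (norm_nonneg _).trans (hK 0 (by simp))
  -- Because `DG · X = DX · G`, both `Y t (G p)` and `G (φ p t)` solve the variational equation with
  -- the same initial value; their difference solves it from zero.
  have := norm_le_of_norm_deriv_le (e := fun t => Y t (G p) - G (φ p t))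
    (e' := fun t => fderiv ℝ X (φ p t) (Y t (G p) - G (φ p t))) (K := K) (ε := 0) hK0 le_rfl
    (fun t ht => ?_) (by simp [hY0, (h p).1])
    (fun t ht => by
      rw [add_zero]
      exact (ContinuousLinearMap.le_opNorm _ _).trans
        (mul_le_mul_of_nonneg_right (hK t ht) (norm_nonneg _))) 1 (by simp)
  · rw [zero_mul] at this
    exact sub_eq_zero.1 (norm_le_zero_iff.1 this)
  · have h1 := (hYd t ht).clm_apply (hasDerivWithinAt_const t _ (G p))
    have h2 := (hG.differentiable one_ne_zero (φ p t)).hasFDerivAt.comp_hasDerivWithinAt t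
      ((h p).2 t ht)
    refine (h1.sub h2).congr_deriv ?_
    have h3 := hcomm (φ p t)
    rw [VectorField.lieBracket, sub_eq_zero] at h3
    simp [h3]

end Flow

end Impulsive

/-! ### Global flows of complete fields. -/

namespace Impulsive

/-- The global flow of a complete field `X` of class `C²`. -/
structure IsFlow {E : Type*} [NormedAddCommGroup E] [NormedSpace ℝ E] (X : E → E)
    (Φ : ℝ × E → E) : Prop where
  contDiff : ContDiff ℝ 2 Φ
  map_zero : ∀ p, Φ (0, p) = p
  hasDerivAt : ∀ p s, HasDerivAt (fun s => Φ (s, p)) (X (Φ (s, p))) s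
  fderiv_apply : ∀ G : E → E, ContDiff ℝ 1 G → (∀ p, VectorField.lieBracket ℝ X G p = 0) →
    ∀ s p, fderiv ℝ Φ (s, p) (0, G p) = G (Φ (s, p))

section Flow

variable {E : Type*} [NormedAddCommGroup E] [NormedSpace ℝ E]

theorem IsFlow.fderiv_one_zero {X : E → E} {Φ : ℝ × E → E} (h : IsFlow X Φ) (s : ℝ) (p : E) :
    fderiv ℝ Φ (s, p) (1, 0) = X (Φ (s, p)) := by
  have h1 := ((h.contDiff.differentiable two_ne_zero (s, p)).hasFDerivAt).comp_hasDerivAt s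
    ((hasDerivAt_id s).prodMk (hasDerivAt_const s p))
  exact h1.unique (h.hasDerivAt p s)

theorem IsFlow.fderiv_eq {X : E → E} {Φ : ℝ × E → E} (h : IsFlow X Φ) (s : ℝ) (p : E)
    (c : ℝ) (v : E) :
    fderiv ℝ Φ (s, p) (c, v) = c • X (Φ (s, p)) + fderiv ℝ Φ (s, p) (0, v) := by
  have : ((c, v) : ℝ × E) = c • ((1, 0) : ℝ × E) + (0, v) := by simp
  rw [this, map_add, map_smul, h.fderiv_one_zero]

/-- The derivative in `s` vanishes: moving the time contributes `-X`, and moving the point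
contributes `X`, since `X` is invariant under its own flow. -/
theorem IsFlow.neg_comp {X : E → E} {Φ : ℝ × E → E} (h : IsFlow X Φ) (hX : ContDiff ℝ 1 X)
    (s : ℝ) (p : E) : Φ (-s, Φ (s, p)) = p := by
  have hd : ∀ s, HasDerivAt (fun s => Φ (-s, Φ (s, p))) 0 s := by
    intro s
    have h1 := ((h.contDiff.differentiable two_ne_zero (-s, Φ (s, p))).hasFDerivAt).comp_hasDerivAt
      s ((hasDerivAt_id s).neg.prodMk (h.hasDerivAt p s))
    refine h1.congr_deriv ?_
    rw [h.fderiv_eq, h.fderiv_apply X hX (fun p => by simp)]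
    simp
  have := is_const_of_deriv_eq_zero (fun s => (hd s).differentiableAt) (fun s => (hd s).deriv) s 0
  simpa [h.map_zero] using this

/-- Joint regularity in time and state comes from making time a parameter. The field `(0, s • X)` on
`ℝ × E` has time-one map `(s, p) ↦ (s, γ p s)`, so regularity of time-one maps suffices. Invariance
at time `s` is that of the time-one map of `s • X`. -/
theorem exists_isFlow [FiniteDimensional ℝ E] {X : E → E} (hX : ContDiff ℝ 2 X)
    (hcomplete : ∀ p, ∃ γ : ℝ → E, γ 0 = p ∧ ∀ t, HasDerivAt γ (X (γ t)) t) :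
    ∃ Φ : ℝ × E → E, IsFlow X Φ := by
  choose γ h0 hd using hcomplete
  have hX1 : ContDiff ℝ 1 X := hX.of_le one_le_two
  have hflow : IsUnitFlow (E := ℝ × E) (fun p => (0, p.1 • X p.2))
      (fun p t => (p.1, γ p.2 (p.1 * t))) := by
    intro p
    refine ⟨by simp [h0], fun t ht => ?_⟩
    refine (hasDerivWithinAt_const t _ p.1).prodMk (HasDerivAt.hasDerivWithinAt ?_)
    have := (hd p.2 (p.1 * t)).scomp t ((hasDerivAt_id t).const_mul p.1)
    simpa [Function.comp_def] using this
  have hC : ContDiff ℝ 2 fun p : ℝ × E => γ p.2 p.1 := by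
    have := contDiff_snd.comp (hflow.contDiff_two (by fun_prop))
    simpa [Function.comp_def] using this
  refine ⟨fun p => γ p.2 p.1, hC, h0, hd, fun G hG hcomm s p => ?_⟩
  have hs : IsUnitFlow (s • X) (fun p t => γ p (s * t)) := by
    intro p
    refine ⟨by simp [h0], fun t ht => HasDerivAt.hasDerivWithinAt ?_⟩
    have := (hd p (s * t)).scomp t ((hasDerivAt_id t).const_mul s)
    simpa [Function.comp_def] using this
  have h1 := hs.fderiv_apply_of_lieBracket_eq_zero (contDiff_const.smul hX1) hG (fun p => by
    rw [VectorField.lieBracket_const_smul_left (hX1.differentiable one_ne_zero p), hcomm,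
      smul_zero]) p
  simp only [mul_one] at h1
  rw [← h1]
  have h2 := (hC.differentiable two_ne_zero (s, p)).hasFDerivAt.comp p
    ((hasFDerivAt_const s p).prodMk (hasFDerivAt_id p))
  have h3 : fderiv ℝ (fun q => γ q s) p = _ := h2.fderiv
  rw [h3]
  simp

end Flow

/-! ### Simultaneous straightening of the commuting fields. -/

section Rectification

variable {n m : ℕ}

theorem IsFlow.snd_apply
    {g : Fin m → ℝ^[n] → ℝ^[m] → ℝ^[n]}
    {α : Fin m} {Φ : ℝ × (ℝ^[n] × ℝ^[m]) → (ℝ^[n] × ℝ^[m])} (h : IsFlow (field g α) Φ)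
    (s : ℝ) (p : ℝ^[n] × ℝ^[m]) (β : Fin m) :
    (Φ (s, p)).2 β = p.2 β + if β = α then s else 0 := by
  have hd : ∀ s, HasDerivAt (fun s => (Φ (s, p)).2 β - s * if β = α then 1 else 0) 0 s := by
    intro s
    have h1 := (h.hasDerivAt p s).snd
    have h2 := (EuclideanSpace.proj (𝕜 := ℝ) β).hasFDerivAt.comp_hasDerivAt s h1
    refine (h2.sub ((hasDerivAt_id s).mul_const (if β = α then (1 : ℝ) else 0))).congr_deriv ?_
    simp [field]
  have := is_const_of_deriv_eq_zero (fun s => (hd s).differentiableAt) (fun s => (hd s).deriv) s 0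
  simp only [h.map_zero, zero_mul, sub_zero] at this
  rw [← this]
  split_ifs <;> simp

/-- Flowing back along the fields in `l` until the corresponding components of `z` vanish. -/
theorem exists_partial_rectification
    {g : Fin m → ℝ^[n] → ℝ^[m] → ℝ^[n]}
    (hg : ∀ α, ContDiff ℝ 2 (field g α))
    (hcomplete : ∀ α p, ∃ γ : ℝ → (ℝ^[n] × ℝ^[m]), γ 0 = p ∧ ∀ t, HasDerivAt γ (field g α (γ t)) t)
    (hcomm : ∀ α β p, VectorField.lieBracket ℝ (field g α) (field g β) p = 0)
    (l : List (Fin m)) (hl : l.Nodup) :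
    ∃ (R : (ℝ^[n] × ℝ^[m]) → (ℝ^[n] × ℝ^[m])) (J : ℝ^[m] × (ℝ^[n] × ℝ^[m]) → (ℝ^[n] × ℝ^[m])),
      ContDiff ℝ 2 R ∧ ContDiff ℝ 2 J ∧
      (∀ p β, (R p).2 β = if β ∈ l then 0 else p.2 β) ∧
      (∀ z q β, (J (z, q)).2 β = q.2 β + if β ∈ l then z β else 0) ∧
      (∀ p β, fderiv ℝ R p (field g β p) = if β ∈ l then 0 else field g β (R p)) ∧
      (∀ z p, (∀ β ∈ l, z β = p.2 β) → J (z, R p) = p) ∧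
      (∀ z q, (∀ β ∈ l, q.2 β = 0) → R (J (z, q)) = q) := by
  induction l with
  | nil =>
    refine ⟨id, Prod.snd, contDiff_id, contDiff_snd, ?_, ?_, ?_, ?_, ?_⟩ <;> simp
  | cons α l ih =>
    obtain ⟨hα, hl'⟩ := List.nodup_cons.1 hl
    obtain ⟨R, J, hR, hJ, hR2, hJ2, hRg, hJR, hRJ⟩ := ih hl'
    obtain ⟨Φ, hΦ⟩ := exists_isFlow (hg α) (hcomplete α)
    have hg1 : ∀ β, ContDiff ℝ 1 (field g β) := fun β => (hg β).of_le one_le_two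
    have hproj : ContDiff ℝ 2 fun p : (ℝ^[n] × ℝ^[m]) => -p.2 α :=
      ((EuclideanSpace.proj (𝕜 := ℝ) α).contDiff.comp contDiff_snd).neg
    have hρ : ContDiff ℝ 2 fun p : (ℝ^[n] × ℝ^[m]) => Φ (-p.2 α, p) :=
      hΦ.contDiff.comp (hproj.prodMk contDiff_id)
    have hρ2 : ∀ (p : (ℝ^[n] × ℝ^[m])) β, (Φ (-p.2 α, p)).2 β = if β = α then 0 else p.2 β := by
      intro p β
      rw [hΦ.snd_apply]
      split_ifs with h <;> simp [h]
    -- `R` first cancels the component `α` and then those in `l`; `J` undoes this in the opposite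
    -- order.
    refine ⟨fun p => R (Φ (-p.2 α, p)), fun w => Φ (w.1 α, J w), hR.comp hρ, ?_, ?_, ?_, ?_, ?_,
      ?_⟩
    · exact hΦ.contDiff.comp
        (((EuclideanSpace.proj (𝕜 := ℝ) α).contDiff.comp contDiff_fst).prodMk hJ)
    · intro p β
      rw [hR2, hρ2]
      by_cases h1 : β = α <;> by_cases h2 : β ∈ l <;> simp [h1, h2]
    · intro z q β
      rw [hΦ.snd_apply, hJ2]
      by_cases h1 : β = α
      · subst h1; simp [hα]
      · simp [h1]
    · intro p β
      have h1 : HasFDerivAt (fun p : (ℝ^[n] × ℝ^[m]) => -p.2 α)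
          (-((EuclideanSpace.proj (𝕜 := ℝ) α).comp (ContinuousLinearMap.snd ℝ _ _))) p :=
        ((EuclideanSpace.proj (𝕜 := ℝ) α).comp
          (ContinuousLinearMap.snd ℝ (ℝ^[n]) _)).hasFDerivAt.neg
      have h2 := HasFDerivAt.comp (f := fun p : (ℝ^[n] × ℝ^[m]) => (-p.2 α, p)) p
        (hΦ.contDiff.differentiable two_ne_zero (-p.2 α, p)).hasFDerivAt
        (h1.prodMk (hasFDerivAt_id p))
      have h3 := ((hR.differentiable two_ne_zero _).hasFDerivAt).comp p h2
      have h4 : fderiv ℝ (fun p => R (Φ (-p.2 α, p))) p = _ := h3.fderiv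
      rw [h4]
      simp only [ContinuousLinearMap.comp_apply, ContinuousLinearMap.prod_apply,
        _root_.neg_apply, ContinuousLinearMap.coe_snd', ContinuousLinearMap.id_apply,
        Function.comp_apply]
      -- The derivative of `p ↦ Φ (-p.2 α, p)` along `g_β` is `g_β` minus the `α`-component of `e_β`
      -- times `g_α`. It cancels when `β = α`; otherwise it is `g_β`, to which the induction
      -- hypothesis applies.
      rw [hΦ.fderiv_eq, hΦ.fderiv_apply _ (hg1 β) (hcomm α β)]
      by_cases h5 : β = α
      · subst h5
        have : ((EuclideanSpace.proj (𝕜 := ℝ) β) (field g β p).2 : ℝ) = 1 := by simp [field]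
        rw [this, neg_smul, one_smul, neg_add_cancel, map_zero]
        simp
      · have : ((EuclideanSpace.proj (𝕜 := ℝ) α) (field g β p).2 : ℝ) = 0 := by
          simp [field, Ne.symm h5]
        rw [this, neg_zero, zero_smul, zero_add, hRg]
        simp [h5]
    · intro z p hz
      simp only
      rw [hJR, hz α (by simp)]
      · simpa using hΦ.neg_comp (hg1 α) (-p.2 α) p
      · intro β hβ
        rw [hρ2, hz β (by simp [hβ]), if_neg (by rintro rfl; exact hα hβ)]
    · intro z q hq
      simp only
      have h1 : (Φ (z α, J (z, q))).2 α = z α := by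
        rw [hΦ.snd_apply, hJ2, hq α (by simp)]
        simp [hα]
      rw [h1, hΦ.neg_comp (hg1 α), hRJ]
      exact fun β hβ => hq β (by simp [hβ])

/-- The change of coordinates `p ↦ (P p, p.2)`, with inverse `Ψ`, straightens the fields `g_α`. -/
structure IsRectification
    (g : Fin m → ℝ^[n] → ℝ^[m] → ℝ^[n])
    (P : (ℝ^[n] × ℝ^[m]) → ℝ^[n]) (Ψ : (ℝ^[n] × ℝ^[m]) → (ℝ^[n] × ℝ^[m])) : Prop where
  contDiff : ContDiff ℝ 2 P
  contDiff_symm : ContDiff ℝ 2 Ψ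
  symm_snd : ∀ q, (Ψ q).2 = q.2
  symm_apply : ∀ p, Ψ (P p, p.2) = p
  apply_symm : ∀ q, P (Ψ q) = q.1
  fderiv_field : ∀ p α, fderiv ℝ P p (field g α p) = 0

/-- Once all indices are treated, `R` takes values in `z = 0` and its derivative kills every `g_α`.
Only the `x`-component of `R` carries information, and `J` started from `z = 0` recovers the point.
-/
theorem exists_isRectification
    {g : Fin m → ℝ^[n] → ℝ^[m] → ℝ^[n]}
    (hg : ∀ α, ContDiff ℝ 2 (field g α))
    (hcomplete : ∀ α p, ∃ γ : ℝ → (ℝ^[n] × ℝ^[m]), γ 0 = p ∧ ∀ t, HasDerivAt γ (field g α (γ t)) t)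
    (hcomm : ∀ α β p, VectorField.lieBracket ℝ (field g α) (field g β) p = 0) :
    ∃ P Ψ, IsRectification g P Ψ := by
  obtain ⟨R, J, hR, hJ, hR2, hJ2, hRg, hJR, hRJ⟩ :=
    exists_partial_rectification hg hcomplete hcomm (List.finRange m) (List.nodup_finRange m)
  simp only [List.mem_finRange, if_true, forall_const] at hR2 hJ2 hRg hJR hRJ
  refine ⟨fun p => (R p).1, fun q => J (q.2, (q.1, 0)), hR.fst, by fun_prop, ?_, ?_, ?_, ?_⟩
  · intro q
    ext β
    simp [hJ2]
  · intro p
    have : ((R p).1, (0 : ℝ^[m])) = R p :=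
      Prod.ext rfl (by ext β; simp [hR2])
    simp only [this]
    exact hJR _ _ fun _ => rfl
  · intro q
    rw [hRJ _ _ (by simp)]
  · intro p α
    have := (hR.differentiable two_ne_zero p).hasFDerivAt.fst.fderiv
    rw [this]
    simp [hRg]

end Rectification

end Impulsive

namespace Impulsive

/-! ### Absolutely continuous curves: chain rule and Grönwall. -/

section IntegralCurve

variable {E F : Type*} [NormedAddCommGroup E] [NormedAddCommGroup F]

theorem _root_.AbsolutelyContinuousOnInterval.of_dist_le {X Y : Type*} [PseudoMetricSpace X]
    [PseudoMetricSpace Y] {f : ℝ → X} {I : ℝ → Y} {a b C : ℝ}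
    (hI : AbsolutelyContinuousOnInterval I a b)
    (h : ∀ s ∈ uIcc a b, ∀ t ∈ uIcc a b, dist (f s) (f t) ≤ C * dist (I s) (I t)) :
    AbsolutelyContinuousOnInterval f a b := by
  rw [absolutelyContinuousOnInterval_iff] at hI ⊢
  intro ε hε
  -- `|C| + 1` is positive whatever the sign of `C`.
  obtain ⟨δ, hδ, H⟩ := hI (ε / (|C| + 1)) (by positivity)
  refine ⟨δ, hδ, fun D hD hlt => ?_⟩
  have h1 : ∑ i ∈ Finset.range D.1, dist (f (D.2 i).1) (f (D.2 i).2) ≤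
      ∑ i ∈ Finset.range D.1, (|C| + 1) * dist (I (D.2 i).1) (I (D.2 i).2) := by
    refine Finset.sum_le_sum fun i hi => (h _ (hD.1 i hi).1 _ (hD.1 i hi).2).trans ?_
    exact mul_le_mul_of_nonneg_right ((le_abs_self C).trans (by linarith)) dist_nonneg
  rw [← Finset.mul_sum] at h1
  have h2 := H D hD hlt
  rw [lt_div_iff₀ (by positivity)] at h2
  linarith

variable [NormedSpace ℝ E] [NormedSpace ℝ F]

theorem dist_primitive_le {h : ℝ → E} {k : ℝ → ℝ} {a b : ℝ}
    (hh : IntervalIntegrable h volume a b) (hk : IntervalIntegrable k volume a b)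
    (hle : ∀ s, ‖h s‖ ≤ k s) {s t : ℝ} (hs : s ∈ uIcc a b) (ht : t ∈ uIcc a b) :
    dist (∫ r in a..s, h r) (∫ r in a..t, h r) ≤
      dist (∫ r in a..s, k r) (∫ r in a..t, k r) := by
  have has : uIcc a s ⊆ uIcc a b := uIcc_subset_uIcc_left hs
  have hat : uIcc a t ⊆ uIcc a b := uIcc_subset_uIcc_left ht
  rw [dist_eq_norm, dist_eq_norm,
    intervalIntegral.integral_interval_sub_left (hh.mono_set has) (hh.mono_set hat),
    intervalIntegral.integral_interval_sub_left (hk.mono_set has) (hk.mono_set hat),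
    Real.norm_eq_abs]
  exact intervalIntegral.norm_integral_le_abs_of_norm_le (ae_of_all _ fun _ => hle _)
    (hk.mono_set (uIcc_subset_uIcc ht hs))

theorem continuousOn_of_eq_integral {h W : ℝ → E} {W₀ : E} {τ : ℝ} (hτ : 0 ≤ τ)
    (hh : IntervalIntegrable h volume 0 τ)
    (hW : ∀ t ∈ Icc 0 τ, W t = W₀ + ∫ s in (0 : ℝ)..t, h s) : ContinuousOn W (Icc 0 τ) := by
  have := intervalIntegral.continuousOn_primitive_interval' hh (left_mem_uIcc)
  rw [uIcc_of_le hτ] at this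
  exact (continuousOn_const.add this).congr hW

theorem intervalIntegrable_clm_apply {A : ℝ → E →L[ℝ] F} {h : ℝ → E} {a b : ℝ}
    (hA : ContinuousOn A (uIcc a b)) (hh : IntervalIntegrable h volume a b) :
    IntervalIntegrable (fun s => A s (h s)) volume a b := by
  obtain ⟨K, hK⟩ := isCompact_uIcc.exists_bound_of_continuousOn hA
  rw [intervalIntegrable_iff] at hh ⊢
  have hA' : AEStronglyMeasurable A (volume.restrict (uIoc a b)) :=
    (hA.mono uIoc_subset_uIcc).aestronglyMeasurable measurableSet_uIoc
  refine (hh.norm.const_mul K).mono'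
    (isBoundedBilinearMap_apply.continuous.comp_aestronglyMeasurable
      (hA'.prodMk hh.aestronglyMeasurable)) ?_
  refine (ae_restrict_iff' measurableSet_uIoc).2 (ae_of_all _ fun s hs => ?_)
  exact (ContinuousLinearMap.le_opNorm _ _).trans
    (mul_le_mul_of_nonneg_right (hK s (uIoc_subset_uIcc hs)) (norm_nonneg _))

/-- The chain rule for absolutely continuous curves, in integral form. -/
theorem comp_integral_curve [FiniteDimensional ℝ E] [CompleteSpace F] {Θ : E → F}
    (hΘ : ContDiff ℝ 1 Θ)
    {h W : ℝ → E} {W₀ : E} {τ : ℝ} (hτ : 0 ≤ τ) (hh : IntervalIntegrable h volume 0 τ)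
    (hW : ∀ t ∈ Icc 0 τ, W t = W₀ + ∫ s in (0 : ℝ)..t, h s) :
    IntervalIntegrable (fun s => fderiv ℝ Θ (W s) (h s)) volume 0 τ ∧
      ∀ t ∈ Icc 0 τ, Θ (W t) = Θ W₀ + ∫ s in (0 : ℝ)..t, fderiv ℝ Θ (W s) (h s) := by
  have : CompleteSpace E := FiniteDimensional.complete ℝ E
  have hWc := continuousOn_of_eq_integral hτ hh hW
  have hA : ContinuousOn (fun s => fderiv ℝ Θ (W s)) (uIcc 0 τ) := by
    rw [uIcc_of_le hτ]
    exact (hΘ.continuous_fderiv one_ne_zero).comp_continuousOn hWc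
  have hint := intervalIntegrable_clm_apply hA hh
  refine ⟨hint, ?_⟩
  obtain ⟨R, hR⟩ := isCompact_Icc.exists_bound_of_continuousOn hWc
  obtain ⟨L, hL⟩ := hΘ.contDiffOn.exists_lipschitzOnWith (s := Metric.closedBall 0 R)
    one_ne_zero (convex_closedBall _ _) (isCompact_closedBall _ _)
  -- `W` is arbitrary outside `[0, τ]`; the primitive `V` agrees with it there and has two-sided
  -- derivatives almost everywhere.
  set V : ℝ → E := fun t => W₀ + ∫ s in (0 : ℝ)..t, h s with hV
  have hVW : ∀ t ∈ Icc 0 τ, V t = W t := fun t ht => (hW t ht).symm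
  have hac1 : AbsolutelyContinuousOnInterval (fun t => Θ (V t)) 0 τ := by
    refine (hh.norm.absolutelyContinuousOnInterval_intervalIntegral left_mem_uIcc).of_dist_le
      (C := L) fun s hs t ht => ?_
    have hs' := uIcc_of_le hτ ▸ hs
    have ht' := uIcc_of_le hτ ▸ ht
    refine (hL.dist_le_mul (V s) (by simpa [hVW s hs'] using hR s hs') (V t)
      (by simpa [hVW t ht'] using hR t ht')).trans ?_
    refine mul_le_mul_of_nonneg_left ?_ L.coe_nonneg
    rw [hV, dist_add_left]
    exact dist_primitive_le hh hh.norm (fun _ => le_rfl) hs ht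
  have hac2 : AbsolutelyContinuousOnInterval
      (fun t => ∫ s in (0 : ℝ)..t, fderiv ℝ Θ (W s) (h s)) 0 τ := by
    refine (hint.norm.absolutelyContinuousOnInterval_intervalIntegral left_mem_uIcc).of_dist_le
      (C := 1) fun s hs t ht => ?_
    rw [one_mul]
    exact dist_primitive_le hint hint.norm (fun _ => le_rfl) hs ht
  -- An absolutely continuous function with zero derivative almost everywhere is constant.
  obtain ⟨c, hc⟩ := (hac1.sub hac2).const_of_ae_hasDerivAt_zero (by
    filter_upwards [hh.ae_hasDerivAt_integral, hint.ae_hasDerivAt_integral] with x hx1 hx2 hx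
    have h1 : HasDerivAt V (h x) x := (hx1 hx 0 left_mem_uIcc).const_add W₀
    have h2 := ((hΘ.differentiable one_ne_zero (V x)).hasFDerivAt).comp_hasDerivAt x h1
    have h3 := h2.sub (hx2 hx 0 left_mem_uIcc)
    rwa [hVW x (uIcc_of_le hτ ▸ hx), sub_self] at h3)
  intro t ht
  have h0 := hc 0 left_mem_uIcc
  have h1 := hc t (by rwa [uIcc_of_le hτ])
  simp only [Pi.sub_apply, hV, intervalIntegral.integral_same, add_zero, sub_zero] at h0 h1
  rw [hW t ht, h0, ← h1]
  abel

/-- Grönwall's inequality for two curves given as primitives. -/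
theorem norm_sub_le_of_integral_curves {y₁ y₂ h₁ h₂ : ℝ → E} {c₁ c₂ : E} {e : ℝ → ℝ} {L T : ℝ}
    (hT : 0 ≤ T) (hL : 0 ≤ L)
    (hh₁ : IntegrableOn h₁ (Icc 0 T)) (hh₂ : IntegrableOn h₂ (Icc 0 T))
    (hy₁ : ∀ t ∈ Icc 0 T, y₁ t = c₁ + ∫ s in (0 : ℝ)..t, h₁ s)
    (hy₂ : ∀ t ∈ Icc 0 T, y₂ t = c₂ + ∫ s in (0 : ℝ)..t, h₂ s)
    (he : IntegrableOn e (Icc 0 T)) (he0 : ∀ t, 0 ≤ e t)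
    (hle : ∀ᵐ t ∂(volume.restrict (Icc 0 T)), ‖h₁ t - h₂ t‖ ≤ L * ‖y₁ t - y₂ t‖ + e t) :
    ∀ t ∈ Icc 0 T, ‖y₁ t - y₂ t‖ ≤ (‖c₁ - c₂‖ + ∫ s in Icc 0 T, e s) * Real.exp (L * T) := by
  have hTm : T ∈ Icc 0 T := ⟨hT, le_rfl⟩
  have hc : ContinuousOn (fun t => ‖y₁ t - y₂ t‖) (Icc 0 T) :=
    ((continuousOn_of_eq_integral hT (hh₁.intervalIntegrable_zero hTm) hy₁).sub
      (continuousOn_of_eq_integral hT (hh₂.intervalIntegrable_zero hTm) hy₂)).norm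
  have hci := hc.integrableOn_Icc (μ := volume)
  set D := ‖c₁ - c₂‖ + ∫ s in Icc 0 T, e s with hD
  have hD0 : 0 ≤ D := add_nonneg (norm_nonneg _) (integral_nonneg he0)
  -- The forcing `e` is only integrable, so its whole integral goes into the constant `D`. The
  -- majorant `G` is then differentiable, with `G' ≤ L * G`.
  set G : ℝ → ℝ := fun t => D + L * ∫ s in (0 : ℝ)..t, ‖y₁ s - y₂ s‖ with hG
  have hG0 : ∀ t, 0 ≤ t → 0 ≤ G t := fun t ht =>
    add_nonneg hD0 (mul_nonneg hL (intervalIntegral.integral_nonneg ht fun _ _ => norm_nonneg _))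
  have hyG : ∀ t ∈ Icc 0 T, ‖y₁ t - y₂ t‖ ≤ G t := by
    intro t ht
    rw [hy₁ t ht, hy₂ t ht, add_sub_add_comm, ← intervalIntegral.integral_sub
      (hh₁.intervalIntegrable_zero ht) (hh₂.intervalIntegrable_zero ht)]
    refine (norm_add_le _ _).trans ?_
    have h1 : ‖∫ s in (0 : ℝ)..t, (h₁ s - h₂ s)‖ ≤
        ∫ s in (0 : ℝ)..t, (L * ‖y₁ s - y₂ s‖ + e s) := by
      refine intervalIntegral.norm_integral_le_of_norm_le ht.1 ?_
        (((hci.intervalIntegrable_zero ht).const_mul L).add (he.intervalIntegrable_zero ht))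
      filter_upwards [(ae_restrict_iff' measurableSet_Icc).1 hle] with s hs hst
      exact hs ⟨hst.1.le, hst.2.trans ht.2⟩
    rw [intervalIntegral.integral_add ((hci.intervalIntegrable_zero ht).const_mul L)
      (he.intervalIntegrable_zero ht), intervalIntegral.integral_const_mul] at h1
    have h2 : ∫ s in (0 : ℝ)..t, e s ≤ ∫ s in Icc 0 T, e s := by
      rw [intervalIntegral.integral_of_le ht.1]
      exact setIntegral_mono_set he (ae_of_all _ he0)
        (Ioc_subset_Icc_self.trans (Icc_subset_Icc_right ht.2)).eventuallyLE
    simp only [hG, hD]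
    linarith
  have hGd : ∀ t ∈ Icc 0 T, HasDerivWithinAt G (L * ‖y₁ t - y₂ t‖) (Icc 0 T) t := by
    intro t ht
    have : Fact (t ∈ Icc (0 : ℝ) T) := ⟨ht⟩
    exact ((intervalIntegral.integral_hasDerivWithinAt_right (hci.intervalIntegrable_zero ht)
      (hc.stronglyMeasurableAtFilter_nhdsWithin measurableSet_Icc t) (hc t ht)).const_mul
        L).const_add D
  intro t ht
  have h := norm_le_gronwallBound_of_norm_deriv_right_le (f := G)
    (f' := fun t => L * ‖y₁ t - y₂ t‖) (δ := D) (K := L)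
    (ε := 0) (a := 0) (b := T) (fun t ht => (hGd t ht).continuousWithinAt)
    (fun t ht => ((hGd t (Ico_subset_Icc_self ht)).mono_of_mem_nhdsWithin
      (Icc_mem_nhdsGE_of_mem ht))) (by simp [hG, abs_of_nonneg hD0])
    (fun t ht => by
      rw [add_zero, norm_mul, Real.norm_of_nonneg hL, norm_norm,
        Real.norm_of_nonneg (hG0 t ht.1)]
      exact mul_le_mul_of_nonneg_left (hyG t (Ico_subset_Icc_self ht)) hL) t ht
  rw [gronwallBound_ε0, sub_zero, Real.norm_of_nonneg (hG0 t ht.1)] at h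
  refine (hyG t ht).trans (h.trans (mul_le_mul_of_nonneg_left (Real.exp_le_exp.2 ?_) hD0))
  exact mul_le_mul_of_nonneg_left ht.2 hL

end IntegralCurve

/-- Clamping the coordinates is a non-expansive map of bounded range. -/
theorem exists_retraction {ι : Type*} [Fintype ι] (R : ℝ) :
    ∃ (ρ : EuclideanSpace ℝ ι → EuclideanSpace ℝ ι) (C : ℝ), LipschitzWith 1 ρ ∧
      (∀ y, ‖ρ y‖ ≤ C) ∧ ∀ y, ‖y‖ ≤ R → ρ y = y := by
  refine ⟨fun y => WithLp.toLp 2 fun i => max (-R) (min R (y i)), √(∑ _ : ι, R ^ 2), ?_, ?_, ?_⟩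
  · refine LipschitzWith.of_dist_le_mul fun y y' => ?_
    rw [NNReal.coe_one, one_mul, EuclideanSpace.dist_eq, EuclideanSpace.dist_eq]
    refine Real.sqrt_le_sqrt (Finset.sum_le_sum fun i _ => ?_)
    refine pow_le_pow_left₀ dist_nonneg ?_ 2
    rw [Real.dist_eq, Real.dist_eq]
    refine (abs_max_sub_max_le_max _ _ _ _).trans (max_le (by simp) ?_)
    exact (abs_min_sub_min_le_max _ _ _ _).trans (max_le (by simp) le_rfl)
  · intro y
    rw [EuclideanSpace.norm_eq]
    refine Real.sqrt_le_sqrt (Finset.sum_le_sum fun i _ => ?_)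
    rw [Real.norm_eq_abs, sq_abs]
    simp only
    by_cases hR : 0 ≤ R
    · exact sq_le_sq' (le_max_left _ _) (max_le (by linarith) (min_le_left _ _))
    · have : max (-R) (min R (y i)) = -R :=
        max_eq_left ((min_le_left _ _).trans (by linarith))
      rw [this, neg_sq]
  · intro y hy
    ext i
    have h1 : |y i| ≤ R := (PiLp.norm_apply_le y i).trans hy
    rw [abs_le] at h1
    simp [h1.1, h1.2]

end Impulsive

/-! ### The drift and the solutions in straightened coordinates. -/

namespace Impulsive

variable {n m l : ℕ}

/-- The assumptions on the drift: `f(·, ·, b)` is locally Lipschitz uniformly in `b ∈ A`,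
`f(x, z, ·)` is continuous on `A`, and `f` has linear growth. -/
structure IsRegularDrift (U : Set ℝ^[m]) (A : Set ℝ^[l]) (f : ℝ^[n] → ℝ^[m] → ℝ^[l] → ℝ^[n]) :
    Prop where
  isClosed_left : IsClosed U
  isClosed_right : IsClosed A
  lipschitz : ∀ K : Set (ℝ^[n] × ℝ^[m]), IsCompact K → K ⊆ univ ×ˢ U →
    ∃ L : NNReal, ∀ b ∈ A, LipschitzOnWith L (fun p => f p.1 p.2 b) K
  continuousOn_right : ∀ x, ∀ z ∈ U, ContinuousOn (f x z) A
  growth : ∃ M : ℝ, 0 < M ∧ ∀ x, ∀ z ∈ U, ∀ b ∈ A, ‖f x z b‖ ≤ M * (1 + ‖(x, z)‖)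

variable {U : Set ℝ^[m]} {A : Set ℝ^[l]} {f : ℝ^[n] → ℝ^[m] → ℝ^[l] → ℝ^[n]}

/-- Separate regularity suffices because the Lipschitz constant in the state does not depend on `b`.
Joint continuity is what makes the composition with measurable inputs measurable. -/
theorem IsRegularDrift.continuousOn (hf : IsRegularDrift U A f) :
    ContinuousOn (fun r : (ℝ^[n] × ℝ^[m]) × ℝ^[l] => f r.1.1 r.1.2 r.2) ((univ ×ˢ U) ×ˢ A) := by
  rintro ⟨p, b⟩ ⟨⟨-, hp⟩, hb⟩
  obtain ⟨L, hL⟩ := hf.lipschitz (Metric.closedBall p 1 ∩ univ ×ˢ U)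
    ((isCompact_closedBall p 1).inter_right (isClosed_univ.prod hf.isClosed_left))
    inter_subset_right
  have hpm : p ∈ Metric.closedBall p 1 ∩ univ ×ˢ U := ⟨by simp, trivial, hp⟩
  have h1 : Tendsto (fun r : (ℝ^[n] × ℝ^[m]) × ℝ^[l] => f p.1 p.2 r.2) (𝓝[(univ ×ˢ U) ×ˢ A] (p, b))
      (𝓝 (f p.1 p.2 b)) := by
    refine (hf.continuousOn_right p.1 p.2 hp b hb).tendsto.comp ?_
    refine tendsto_nhdsWithin_iff.2 ⟨(continuous_snd.tendsto _).mono_left nhdsWithin_le_nhds, ?_⟩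
    filter_upwards [self_mem_nhdsWithin] with r hr using hr.2
  have h2 : Tendsto (fun r : (ℝ^[n] × ℝ^[m]) × ℝ^[l] => f r.1.1 r.1.2 r.2 - f p.1 p.2 r.2)
      (𝓝[(univ ×ˢ U) ×ˢ A] (p, b)) (𝓝 0) := by
    have hd : Tendsto (fun r : (ℝ^[n] × ℝ^[m]) × ℝ^[l] => L * ‖r.1 - p‖)
        (𝓝[(univ ×ˢ U) ×ˢ A] (p, b)) (𝓝 0) := by
      have : Tendsto (fun r : (ℝ^[n] × ℝ^[m]) × ℝ^[l] => L * ‖r.1 - p‖) (𝓝 (p, b))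
          (𝓝 (L * ‖p - p‖)) :=
        Continuous.tendsto (f := fun r : (ℝ^[n] × ℝ^[m]) × ℝ^[l] => L * ‖r.1 - p‖)
          (by fun_prop) (p, b)
      rw [sub_self, norm_zero, mul_zero] at this
      exact this.mono_left nhdsWithin_le_nhds
    refine squeeze_zero_norm' ?_ hd
    have hball : ∀ᶠ r : (ℝ^[n] × ℝ^[m]) × ℝ^[l] in 𝓝[(univ ×ˢ U) ×ˢ A] (p, b),
        r.1 ∈ Metric.closedBall p 1 :=
      ((continuous_fst.tendsto (p, b)).mono_left nhdsWithin_le_nhds).eventually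
        (Metric.closedBall_mem_nhds p one_pos)
    filter_upwards [self_mem_nhdsWithin, hball] with r hr hr'
    exact (hL r.2 hr.2).norm_sub_le ⟨hr', hr.1⟩ hpm
  have := h2.add h1
  simpa [ContinuousWithinAt] using this

/-- The drift in the coordinates straightened by `P`, with inverse `Ψ`. -/
noncomputable def reducedField (f : ℝ^[n] → ℝ^[m] → ℝ^[l] → ℝ^[n])
    (P : ℝ^[n] × ℝ^[m] → ℝ^[n]) (Ψ : ℝ^[n] × ℝ^[m] → ℝ^[n] × ℝ^[m]) (b : ℝ^[l])
    (q : ℝ^[n] × ℝ^[m]) : ℝ^[n] :=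
  fderiv ℝ P (Ψ q) (drift f b (Ψ q))

theorem norm_drift (b : ℝ^[l]) (p : ℝ^[n] × ℝ^[m]) : ‖drift f b p‖ = ‖f p.1 p.2 b‖ := by
  simp [drift, Prod.norm_def]

variable {g : Fin m → ℝ^[n] → ℝ^[m] → ℝ^[n]} {P : ℝ^[n] × ℝ^[m] → ℝ^[n]}
  {Ψ : ℝ^[n] × ℝ^[m] → ℝ^[n] × ℝ^[m]}

theorem IsRegularDrift.continuousOn_reducedField (hf : IsRegularDrift U A f)
    (h : IsRectification g P Ψ) :
    ContinuousOn (fun r : (ℝ^[n] × ℝ^[m]) × ℝ^[l] => reducedField f P Ψ r.2 r.1)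
      ((univ ×ˢ U) ×ˢ A) := by
  have hΨ := h.contDiff_symm.continuous
  have h1 : ContinuousOn (fun r : (ℝ^[n] × ℝ^[m]) × ℝ^[l] => f (Ψ r.1).1 (Ψ r.1).2 r.2)
      ((univ ×ˢ U) ×ˢ A) := by
    refine hf.continuousOn.comp (f := fun r : (ℝ^[n] × ℝ^[m]) × ℝ^[l] => (Ψ r.1, r.2))
      (Continuous.continuousOn (by fun_prop)) fun r hr => ⟨⟨trivial, ?_⟩, hr.2⟩
    simpa [h.symm_snd] using hr.1.2
  have h2 : Continuous fun r : (ℝ^[n] × ℝ^[m]) × ℝ^[l] => fderiv ℝ P (Ψ r.1) :=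
    (h.contDiff.continuous_fderiv two_ne_zero).comp (hΨ.comp continuous_fst)
  exact h2.continuousOn.clm_apply (h1.prodMk continuousOn_const)

/-- A product of a bounded Lipschitz operator and a bounded Lipschitz vector. The factor `DP ∘ Ψ` is
`C¹` because `P` is `C²`; the growth condition bounds the drift uniformly in `b`; `Ψ` preserves `z`,
hence membership in `U`. -/
theorem IsRegularDrift.exists_lipschitz_reducedField (hf : IsRegularDrift U A f)
    (h : IsRectification g P Ψ) (C : ℝ) :
    ∃ L ≥ 0, ∃ M, ∀ b ∈ A, ∀ q ∈ Metric.closedBall 0 C ∩ univ ×ˢ U,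
      ‖reducedField f P Ψ b q‖ ≤ M ∧ ∀ q' ∈ Metric.closedBall 0 C ∩ univ ×ˢ U,
      ‖reducedField f P Ψ b q - reducedField f P Ψ b q'‖ ≤ L * ‖q - q'‖ := by
  set K : Set (ℝ^[n] × ℝ^[m]) := Metric.closedBall 0 C ∩ univ ×ˢ U with hK
  have hKc : IsCompact K :=
    (isCompact_closedBall 0 C).inter_right (isClosed_univ.prod hf.isClosed_left)
  have hΨ1 : ContDiff ℝ 1 Ψ := h.contDiff_symm.of_le one_le_two
  have hDP : ContDiff ℝ 1 fun q => fderiv ℝ P (Ψ q) :=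
    (h.contDiff.fderiv_right (m := 1) (by norm_num)).comp hΨ1
  obtain ⟨L₁, hL₁⟩ := hΨ1.contDiffOn.exists_lipschitzOnWith (s := Metric.closedBall 0 C)
    one_ne_zero (convex_closedBall _ _) (isCompact_closedBall _ _)
  obtain ⟨L₂, hL₂⟩ := hDP.contDiffOn.exists_lipschitzOnWith (s := Metric.closedBall 0 C)
    one_ne_zero (convex_closedBall _ _) (isCompact_closedBall _ _)
  obtain ⟨M₂, hM₂⟩ := (isCompact_closedBall (0 : ℝ^[n] × ℝ^[m]) C).exists_bound_of_continuousOn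
    hDP.continuous.continuousOn
  obtain ⟨M₁, hM₁⟩ := (isCompact_closedBall (0 : ℝ^[n] × ℝ^[m]) C).exists_bound_of_continuousOn
    hΨ1.continuous.continuousOn
  obtain ⟨M, hM, hgrowth⟩ := hf.growth
  have hΨK : Ψ '' K ⊆ univ ×ˢ U := by
    rintro _ ⟨q, hq, rfl⟩
    exact ⟨trivial, by simpa [h.symm_snd] using hq.2.2⟩
  obtain ⟨L₃, hL₃⟩ := hf.lipschitz (Ψ '' K) (hKc.image hΨ1.continuous) hΨK
  have hd : ∀ b ∈ A, ∀ q ∈ K, ‖drift f b (Ψ q)‖ ≤ M * (1 + |M₁|) := by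
    intro b hb q hq
    rw [norm_drift]
    refine (hgrowth _ _ (hΨK ⟨q, hq, rfl⟩).2 b hb).trans ?_
    have := (hM₁ q hq.1).trans (le_abs_self M₁)
    simp only [Prod.mk.eta]
    gcongr
  have hd' : ∀ b ∈ A, ∀ q ∈ K, ∀ q' ∈ K, ‖drift f b (Ψ q) - drift f b (Ψ q')‖ ≤
      L₃ * (L₁ * ‖q - q'‖) := by
    intro b hb q hq q' hq'
    have h1 : drift f b (Ψ q) - drift f b (Ψ q') =
        (f (Ψ q).1 (Ψ q).2 b - f (Ψ q').1 (Ψ q').2 b, (0 : ℝ^[m])) := by simp [drift]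
    rw [h1, Prod.norm_def, norm_zero, max_eq_left (norm_nonneg _)]
    refine ((hL₃ b hb).norm_sub_le ⟨q, hq, rfl⟩ ⟨q', hq', rfl⟩).trans ?_
    exact mul_le_mul_of_nonneg_left (hL₁.norm_sub_le hq.1 hq'.1) L₃.coe_nonneg
  refine ⟨L₂ * (M * (1 + |M₁|)) + |M₂| * (L₃ * L₁), by positivity,
    |M₂| * (M * (1 + |M₁|)), fun b hb q hq => ⟨?_, fun q' hq' => ?_⟩⟩
  · refine (ContinuousLinearMap.le_opNorm _ _).trans ?_
    exact mul_le_mul ((hM₂ q hq.1).trans (le_abs_self _)) (hd b hb q hq) (norm_nonneg _)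
      (abs_nonneg _)
  · have h1 : reducedField f P Ψ b q - reducedField f P Ψ b q' =
        (fderiv ℝ P (Ψ q) - fderiv ℝ P (Ψ q')) (drift f b (Ψ q)) +
          fderiv ℝ P (Ψ q') (drift f b (Ψ q) - drift f b (Ψ q')) := by
      simp [reducedField]
    rw [h1]
    refine (norm_add_le _ _).trans ?_
    have h2 : ‖(fderiv ℝ P (Ψ q) - fderiv ℝ P (Ψ q')) (drift f b (Ψ q))‖ ≤
        (L₂ * ‖q - q'‖) * (M * (1 + |M₁|)) :=
      (ContinuousLinearMap.le_opNorm _ _).trans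
        (mul_le_mul (hL₂.norm_sub_le hq.1 hq'.1) (hd b hb q hq) (norm_nonneg _) (by positivity))
    have h3 : ‖fderiv ℝ P (Ψ q') (drift f b (Ψ q) - drift f b (Ψ q'))‖ ≤
        |M₂| * (L₃ * (L₁ * ‖q - q'‖)) :=
      (ContinuousLinearMap.le_opNorm _ _).trans
        (mul_le_mul ((hM₂ q' hq'.1).trans (le_abs_self _)) (hd' b hb q hq q' hq') (norm_nonneg _)
          (abs_nonneg _))
    linarith

/-- The push-forward measure `μ.map q` is carried by `S`, and with respect to it continuity on `S`
is enough. -/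
theorem _root_.ContinuousOn.comp_aestronglyMeasurable {α β γ : Type*} [MeasurableSpace α]
    [TopologicalSpace β] [MeasurableSpace β] [BorelSpace β] [SecondCountableTopology β]
    [TopologicalSpace.PseudoMetrizableSpace β] [TopologicalSpace γ]
    [TopologicalSpace.PseudoMetrizableSpace γ]
    {F : β → γ} {S : Set β} (hF : ContinuousOn F S) (hS : MeasurableSet S) {μ : Measure α}
    {q : α → β} (hq : AEStronglyMeasurable q μ) (hqS : ∀ᵐ t ∂μ, q t ∈ S) :
    AEStronglyMeasurable (fun t => F (q t)) μ := by
  have h1 := hF.aestronglyMeasurable (μ := μ.map q) hS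
  have h2 : (μ.map q).restrict S = μ.map q :=
    Measure.restrict_eq_self_of_ae_mem ((ae_map_iff hq.aemeasurable hS).2 hqS)
  rw [h2] at h1
  exact h1.comp_aemeasurable hq.aemeasurable

theorem IsRegularDrift.integrableOn_reducedField (hf : IsRegularDrift U A f)
    (h : IsRectification g P Ψ) {T C : ℝ} {a : ℝ → ℝ^[l]} (ha : MemL1I T ∅ A a)
    {y : ℝ → ℝ^[n]} {v : ℝ → ℝ^[m]}
    (hy : AEStronglyMeasurable y (volume.restrict (Icc 0 T)))
    (hv : AEStronglyMeasurable v (volume.restrict (Icc 0 T)))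
    (hyC : ∀ᵐ t ∂(volume.restrict (Icc 0 T)), ‖y t‖ ≤ C)
    (hvC : ∀ᵐ t ∂(volume.restrict (Icc 0 T)), ‖v t‖ ≤ C ∧ v t ∈ U) :
    IntegrableOn (fun t => reducedField f P Ψ (a t) (y t, v t)) (Icc 0 T) := by
  obtain ⟨L, -, M, hM⟩ := hf.exists_lipschitz_reducedField h C
  refine Integrable.mono' (integrable_const M) ?_ ?_
  · refine (hf.continuousOn_reducedField h).comp_aestronglyMeasurable
      (((isClosed_univ.prod hf.isClosed_left).prod hf.isClosed_right).measurableSet)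
      (q := fun t => ((y t, v t), a t)) ((hy.prodMk hv).prodMk ha.1.aestronglyMeasurable) ?_
    filter_upwards [hvC, ha.2.2] with t ht ht' using ⟨⟨trivial, ht.2⟩, ht'⟩
  · filter_upwards [hyC, hvC, ha.2.2] with t h1 h2 h3
    exact (hM _ h3 _ ⟨by simpa [Prod.norm_def] using ⟨h1, h2.1⟩, trivial, h2.2⟩).1

theorem rhs_snd (T : ℝ) (v : ℝ → ℝ^[m]) (a : ℝ → ℝ^[l]) (w : ℝ → ℝ^[n] × ℝ^[m]) (s : ℝ) :
    (rhs T f g v a w s).2 = derivWithin v (Icc 0 T) s := by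
  ext β
  simp [rhs, drift, field, Prod.snd_sum, Pi.single_apply]

/-- This is where the control derivative disappears: it only multiplies the fields `g_α`, which `DP`
annihilates. -/
theorem IsRectification.fderiv_rhs (h : IsRectification g P Ψ) (T : ℝ) (v : ℝ → ℝ^[m])
    (a : ℝ → ℝ^[l])
    (w : ℝ → ℝ^[n] × ℝ^[m]) (s : ℝ) :
    fderiv ℝ P (w s) (rhs T f g v a w s) = fderiv ℝ P (w s) (drift f (a s) (w s)) := by
  simp [rhs, h.fderiv_field]

theorem IsC1Control.eq_integral {T : ℝ} {v : ℝ → ℝ^[m]} (hv : IsC1Control T U v) {t : ℝ}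
    (ht : t ∈ Icc 0 T) :
    v t = v 0 + ∫ s in (0 : ℝ)..t, derivWithin v (Icc 0 T) s := by
  rcases ht.1.eq_or_lt with h0 | h0
  · simp [← h0]
  have hT : 0 < T := h0.trans_le ht.2
  have hc : ContinuousOn (derivWithin v (Icc 0 T)) (Icc 0 T) :=
    hv.1.continuousOn_derivWithin (uniqueDiffOn_Icc hT) le_rfl
  rw [intervalIntegral.integral_eq_sub_of_hasDerivAt_of_le ht.1
    (hv.1.continuousOn.mono (Icc_subset_Icc_right ht.2)) (f' := derivWithin v (Icc 0 T))]
  · simp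
  · intro s hs
    have hs' : s ∈ Ioo 0 T := ⟨hs.1, hs.2.trans_le ht.2⟩
    exact (hv.1.differentiableOn one_ne_zero s
      (Ioo_subset_Icc_self hs')).hasDerivWithinAt.hasDerivAt
      (Icc_mem_nhds hs'.1 hs'.2)
  · exact hc.integrableOn_Icc.intervalIntegrable_zero ht

/-- In straightened coordinates, a solution solves an equation without the derivative of the
control. -/
theorem IsSolution.reduced {T : ℝ} (hT : 0 ≤ T) (h : IsRectification g P Ψ) {v : ℝ → ℝ^[m]}
    (hv : IsC1Control T U v) {a : ℝ → ℝ^[l]} {x₀ : ℝ^[n]} {w : ℝ → ℝ^[n] × ℝ^[m]}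
    (hw : IsSolution T f g x₀ v a T w) :
    (∀ t ∈ Icc 0 T, (w t).2 = v t) ∧
      ∀ t ∈ Icc 0 T, P (w t) = P (x₀, v 0) +
        ∫ s in (0 : ℝ)..t, reducedField f P Ψ (a s) (P (w s), v s) := by
  have hsnd : ∀ t ∈ Icc 0 T, (w t).2 = v t := by
    have h1 := (comp_integral_curve (Θ := Prod.snd) contDiff_snd hT hw.1 hw.2).2
    intro t ht
    rw [h1 t ht, hv.eq_integral ht]
    congr 1
    refine intervalIntegral.integral_congr fun s _ => ?_
    rw [fderiv_snd, ContinuousLinearMap.coe_snd', rhs_snd]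
  refine ⟨hsnd, fun t ht => ?_⟩
  rw [(comp_integral_curve (h.contDiff.of_le one_le_two) hT hw.1 hw.2).2 t ht]
  congr 1
  refine intervalIntegral.integral_congr fun s hs => ?_
  rw [uIcc_of_le ht.1] at hs
  rw [h.fderiv_rhs, reducedField, ← hsnd s ⟨hs.1, hs.2.trans ht.2⟩, h.symm_apply]

/-- Going back to the original coordinates, solutions of the reduced equation give solutions. -/
theorem IsRectification.isSolution (h : IsRectification g P Ψ) {T τ : ℝ} (hτ : τ ∈ Icc 0 T)
    {v : ℝ → ℝ^[m]} (hv : IsC1Control T U v) {a : ℝ → ℝ^[l]} {x₀ : ℝ^[n]} {y : ℝ → ℝ^[n]}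
    (hint : IntervalIntegrable (fun s => reducedField f P Ψ (a s) (y s, v s)) volume 0 τ)
    (hy : ∀ t ∈ Icc 0 τ, y t = P (x₀, v 0) +
      ∫ s in (0 : ℝ)..t, reducedField f P Ψ (a s) (y s, v s)) :
    IsSolution T f g x₀ v a τ fun t => Ψ (y t, v t) := by
  have hΨ1 : ContDiff ℝ 1 Ψ := h.contDiff_symm.of_le one_le_two
  have hP1 : ContDiff ℝ 1 P := h.contDiff.of_le one_le_two
  have hvint : IntervalIntegrable (derivWithin v (Icc 0 T)) volume 0 τ := by
    rcases hτ.1.eq_or_lt with h0 | h0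
    · simp [← h0]
    exact (hv.1.continuousOn_derivWithin (uniqueDiffOn_Icc (h0.trans_le hτ.2))
      le_rfl).integrableOn_Icc.intervalIntegrable_zero hτ
  have hpair : IntervalIntegrable (fun s => (reducedField f P Ψ (a s) (y s, v s),
      derivWithin v (Icc 0 T) s)) volume 0 τ := ⟨hint.1.prodMk hvint.1, hint.2.prodMk hvint.2⟩
  -- Differentiating `Ψ (P p, p.2) = p` shows that `DΨ` inverts `(DP, snd)`. Applied to `rhs`, whose
  -- image under `(DP, snd)` is the reduced field paired with the control derivative, this gives
  -- `rhs` back.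
  have hkey : ∀ s, fderiv ℝ Ψ (y s, v s) (reducedField f P Ψ (a s) (y s, v s),
      derivWithin v (Icc 0 T) s) = rhs T f g v a (fun t => Ψ (y t, v t)) s := by
    intro s
    set p := Ψ (y s, v s) with hp
    have hpq : (P p, p.2) = (y s, v s) := by rw [hp, h.apply_symm, h.symm_snd]
    have h1 : HasFDerivAt (fun p => Ψ (P p, p.2)) _ p :=
      HasFDerivAt.comp p (hΨ1.differentiable one_ne_zero _).hasFDerivAt
        ((hP1.differentiable one_ne_zero p).hasFDerivAt.prodMk hasFDerivAt_snd)
    have h2 : (fun p => Ψ (P p, p.2)) = id := funext h.symm_apply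
    rw [h2] at h1
    have h3 := h1.unique (hasFDerivAt_id p)
    have h4 := congrArg (fun B => B (rhs T f g v a (fun t => Ψ (y t, v t)) s)) h3
    simp only [ContinuousLinearMap.comp_apply, ContinuousLinearMap.prod_apply,
      ContinuousLinearMap.coe_snd', ContinuousLinearMap.id_apply] at h4
    rw [hpq, rhs_snd] at h4
    rw [← h4, reducedField, ← hp]
    congr 2
    exact (h.fderiv_rhs T v a (fun t => Ψ (y t, v t)) s).symm
  have := comp_integral_curve hΨ1 (W := fun t => (y t, v t)) (W₀ := (P (x₀, v 0), v 0)) hτ.1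
    hpair (fun t ht => by
      have ht' : t ∈ Icc 0 T := ⟨ht.1, ht.2.trans hτ.2⟩
      have hsub : uIcc 0 t ⊆ uIcc 0 τ := by
        rw [uIcc_of_le ht.1, uIcc_of_le hτ.1]
        exact Icc_subset_Icc_right ht.2
      rw [intervalIntegral.integral_of_le ht.1,
        integral_pair (hint.mono_set hsub).1 (hvint.mono_set hsub).1,
        ← intervalIntegral.integral_of_le ht.1, ← intervalIntegral.integral_of_le ht.1,
        Prod.mk_add_mk, ← hy t ht, ← hv.eq_integral ht'])
  simp only [hkey] at this
  refine ⟨this.1, fun t ht => ?_⟩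
  rw [← h.symm_apply (x₀, v 0)]
  exact this.2 t ht

end Impulsive

namespace Impulsive

/-! ### `L¹_{0}` as the `L¹` space of a measure with an atom at `0`. -/

section TimeMeasure

/-- Lebesgue measure on `[0,T]` together with a unit mass at `0`: the space `L¹_{0}(0,T)` is the
space `L¹` of this measure. -/
noncomputable def timeMeasure (T : ℝ) : Measure ℝ :=
  volume.restrict (Icc 0 T) + Measure.dirac 0

instance (T : ℝ) : IsFiniteMeasure (timeMeasure T) := by
  unfold timeMeasure
  infer_instance

theorem ae_timeMeasure_iff {T : ℝ} {p : ℝ → Prop} :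
    (∀ᵐ t ∂timeMeasure T, p t) ↔ p 0 ∧ ∀ᵐ t ∂(volume.restrict (Icc 0 T)), p t := by
  rw [timeMeasure, ae_add_measure_iff, and_comm, ae_dirac_eq]
  rfl

theorem ae_timeMeasure_of_forall {T : ℝ} (hT : 0 ≤ T) {p : ℝ → Prop} (h : ∀ t ∈ Icc 0 T, p t) :
    ∀ᵐ t ∂timeMeasure T, p t :=
  ae_timeMeasure_iff.2 ⟨h 0 ⟨le_rfl, hT⟩,
    (ae_restrict_iff' measurableSet_Icc).2 (ae_of_all _ h)⟩

theorem eqI_zero_iff {E : Type*} [NormedAddCommGroup E] {T : ℝ} {y z : ℝ → E} :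
    EqI T {0} y z ↔ y =ᵐ[timeMeasure T] z := by
  rw [EventuallyEq, ae_timeMeasure_iff]
  simp [EqI]

variable {E : Type*} [NormedAddCommGroup E] {T : ℝ}

theorem aestronglyMeasurable_timeMeasure {y : ℝ → E}
    (hy : AEStronglyMeasurable y (volume.restrict (Icc 0 T))) :
    AEStronglyMeasurable y (timeMeasure T) :=
  hy.add_measure aestronglyMeasurable_dirac

theorem memL1I_zero_iff {F : Set E} {y : ℝ → E} :
    MemL1I T {0} F y ↔ IntegrableOn y (Icc 0 T) ∧ ∀ᵐ t ∂timeMeasure T, y t ∈ F := by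
  rw [ae_timeMeasure_iff]
  simp [MemL1I]

theorem tendstoL1I_zero_iff {y : ℕ → ℝ → E} {y' : ℝ → E} :
    TendstoL1I T {0} y y' ↔
      Tendsto (fun k => eLpNorm (y k - y') 1 (timeMeasure T)) atTop (𝓝 0) := by
  have h : ∀ k, eLpNorm (y k - y') 1 (timeMeasure T) =
      eLpNorm (y k - y') 1 (volume.restrict (Icc 0 T)) + ‖y k 0 - y' 0‖ₑ := by
    intro k
    rw [eLpNorm_one_eq_lintegral_enorm, timeMeasure, lintegral_add_measure, lintegral_dirac,
      ← eLpNorm_one_eq_lintegral_enorm]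
    rfl
  have h0 : (∀ t ∈ ({0} : Set ℝ), Tendsto (fun k => y k t) atTop (𝓝 (y' t))) ↔
      Tendsto (fun k => ‖y k 0 - y' 0‖ₑ) atTop (𝓝 0) := by
    simp only [mem_singleton_iff, forall_eq]
    rw [tendsto_iff_edist_tendsto_0]
    simp only [edist_eq_enorm_sub]
  simp_rw [TendstoL1I, h0, h]
  constructor
  · rintro ⟨h1, h2⟩
    simpa using h1.add h2
  · intro h1
    exact ⟨tendsto_of_tendsto_of_tendsto_of_le_of_le tendsto_const_nhds h1 (fun _ => zero_le)
      (fun _ => le_self_add), tendsto_of_tendsto_of_tendsto_of_le_of_le tendsto_const_nhds h1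
      (fun _ => zero_le) (fun _ => le_add_self)⟩

end TimeMeasure

/-! ### Smooth curves inside connected open sets. -/

section Paths

variable {E : Type*} [NormedAddCommGroup E] [NormedSpace ℝ E]

/-- `p` and `q` are joined by a `C¹` path in `S`, constant for `t ≤ 0` and for `t ≥ 1`. -/
def JoinedSmoothly (S : Set E) (p q : E) : Prop :=
  ∃ γ : ℝ → E, ContDiff ℝ 1 γ ∧ (∀ t, γ t ∈ S) ∧ (∀ t ≤ 0, γ t = p) ∧ ∀ t ≥ 1, γ t = q

theorem JoinedSmoothly.symm {S : Set E} {p q : E} (h : JoinedSmoothly S p q) :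
    JoinedSmoothly S q p := by
  obtain ⟨γ, hγ, hS, h0, h1⟩ := h
  exact ⟨fun t => γ (1 - t), by fun_prop, fun t => hS _, fun t ht => h1 _ (by linarith),
    fun t ht => h0 _ (by linarith)⟩

/-- Subtracting the common endpoint `q` makes the concatenation a sum: at each time one of the two
paths rests at `q`, so `C¹` regularity needs no gluing. -/
theorem JoinedSmoothly.trans {S : Set E} {p q r : E} (h : JoinedSmoothly S p q)
    (h' : JoinedSmoothly S q r) : JoinedSmoothly S p r := by
  obtain ⟨γ, hγ, hS, h0, h1⟩ := h
  obtain ⟨η, hη, hS', h0', h1'⟩ := h'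
  refine ⟨fun t => γ (2 * t) + η (2 * t - 1) - q, by fun_prop, fun t => ?_, fun t ht => ?_,
    fun t ht => ?_⟩
  · rcases le_total (2 * t) 1 with ht | ht
    · simpa [h0' (2 * t - 1) (by linarith)] using hS (2 * t)
    · simpa [h1 (2 * t) ht] using hS' (2 * t - 1)
  · simp [h0 (2 * t) (by linarith), h0' (2 * t - 1) (by linarith)]
  · simp [h1 (2 * t) (by linarith), h1' (2 * t - 1) (by linarith)]

/-- Being joined is symmetric and transitive, and holds locally: inside a ball, a segment run with a
smooth transition as parameter works. -/
theorem joinedSmoothly_of_isPreconnected {S : Set E} (hS : IsOpen S) (hc : IsPreconnected S)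
    {p q : E} (hp : p ∈ S) (hq : q ∈ S) : JoinedSmoothly S p q := by
  refine hc.induction₂ (JoinedSmoothly S) (fun x hx => ?_) (fun _ _ _ _ _ _ h h' => h.trans h')
    (fun _ _ _ _ h => h.symm) hp hq
  obtain ⟨r, hr, hball⟩ := Metric.isOpen_iff.1 hS x hx
  filter_upwards [mem_nhdsWithin_of_mem_nhds (Metric.ball_mem_nhds x hr)] with y hy
  refine ⟨fun t => x + Real.smoothTransition t • (y - x), ?_, fun t => hball ?_, fun t ht => ?_,
    fun t ht => ?_⟩
  · exact contDiff_const.add ((Real.smoothTransition.contDiff (n := 1)).smul contDiff_const)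
  · rw [mem_ball_iff_norm] at hy ⊢
    rw [add_sub_cancel_left, norm_smul, Real.norm_of_nonneg (Real.smoothTransition.nonneg t)]
    exact (mul_le_of_le_one_left (norm_nonneg _) (Real.smoothTransition.le_one t)).trans_lt hy
  · simp [Real.smoothTransition.zero_of_nonpos ht]
  · simp [Real.smoothTransition.one_of_one_le ht]

/-- Finitely many points of a connected open set lie on a `C¹` curve in that set. -/
theorem exists_contDiff_curve_through {S : Set E} (hS : IsOpen S) (hc : IsConnected S)
    {s : Set E} (hs : s.Finite) (hsS : s ⊆ S) :
    ∃ γ : ℝ → E, ContDiff ℝ 1 γ ∧ (∀ t, γ t ∈ S) ∧ s ⊆ range γ := by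
  -- The induction needs curves that eventually rest, so that the next path can be appended.
  suffices ∃ γ : ℝ → E, ContDiff ℝ 1 γ ∧ (∀ t, γ t ∈ S) ∧ s ⊆ range γ ∧
      ∃ b, ∀ t ≥ b, γ t = γ b by
    obtain ⟨γ, h1, h2, h3, -⟩ := this
    exact ⟨γ, h1, h2, h3⟩
  induction s, hs using Set.Finite.induction_on with
  | empty =>
    obtain ⟨c, hc⟩ := hc.nonempty
    exact ⟨fun _ => c, contDiff_const, fun _ => hc, empty_subset _, 0, fun _ _ => rfl⟩
  | @insert p s _ _ ih =>
    obtain ⟨γ, hγ, hγS, hsγ, b, hb⟩ := ih ((subset_insert p s).trans hsS)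
    obtain ⟨η, hη, hηS, h0, h1⟩ :=
      joinedSmoothly_of_isPreconnected hS hc.isPreconnected (hγS b) (hsS (mem_insert p s))
    have hle : ∀ t ≤ b, γ t + η (t - b) - γ b = γ t := fun t ht => by
      rw [h0 _ (by linarith), add_sub_cancel_right]
    have hge : ∀ t ≥ b, γ t + η (t - b) - γ b = η (t - b) := fun t ht => by
      rw [hb t ht, add_sub_cancel_left]
    refine ⟨fun t => γ t + η (t - b) - γ b, by fun_prop, fun t => ?_, ?_, b + 1, fun t ht => ?_⟩
    · simp only
      rcases le_total t b with ht | ht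
      · rw [hle t ht]; exact hγS t
      · rw [hge t ht]; exact hηS _
    · rintro x (rfl | hx)
      · exact ⟨b + 1, by simp only; rw [hge _ (by linarith), h1 _ (by linarith)]⟩
      · obtain ⟨t, rfl⟩ := hsγ hx
        rcases le_total t b with ht | ht
        · exact ⟨t, hle t ht⟩
        · exact ⟨b, by simp only; rw [hle b le_rfl, hb t ht]⟩
    · simp only
      rw [hge t (by linarith), hge (b + 1) (by linarith), h1 _ (by linarith), h1 _ (by linarith)]

end Paths

/-! ### Density of `C¹` controls. -/

section Approximation

variable {E : Type*} [NormedAddCommGroup E] {T : ℝ}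

/-- Almost everywhere convergence of uniformly bounded maps implies convergence in `L¹`. -/
theorem tendsto_eLpNorm_one_of_bounded {α : Type*} [MeasurableSpace α] {μ : Measure α}
    [IsFiniteMeasure μ] {F : ℕ → α → E} {G : α → E} {C : ℝ}
    (hF : ∀ k, AEStronglyMeasurable (F k) μ) (hG : AEStronglyMeasurable G μ)
    (hFC : ∀ k, ∀ᵐ t ∂μ, ‖F k t‖ ≤ C) (hGC : ∀ᵐ t ∂μ, ‖G t‖ ≤ C)
    (hlim : ∀ᵐ t ∂μ, Tendsto (fun k => F k t) atTop (𝓝 (G t))) :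
    Tendsto (fun k => eLpNorm (F k - G) 1 μ) atTop (𝓝 0) := by
  simp_rw [eLpNorm_one_eq_lintegral_enorm]
  have := tendsto_lintegral_of_dominated_convergence' (μ := μ)
    (F := fun k t => ‖(F k - G) t‖ₑ) (f := fun _ => 0) (fun _ => ENNReal.ofReal (2 * C))
    (fun k => ((hF k).sub hG).enorm) (fun k => ?_) ?_ ?_
  · simpa using this
  · filter_upwards [hFC k, hGC] with t h1 h2
    rw [← ofReal_norm]
    refine ENNReal.ofReal_le_ofReal ((norm_sub_le _ _).trans (by linarith))
  · rw [lintegral_const]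
    exact ENNReal.mul_ne_top ENNReal.ofReal_ne_top (measure_ne_top _ _)
  · filter_upwards [hlim] with t ht
    have h := tendsto_iff_edist_tendsto_0.1 ht
    simpa only [edist_eq_enorm_sub, Pi.sub_apply] using h

/-- Bounded continuous functions are dense in `L¹`, and Weierstrass approximates them uniformly on
`[0,T]`, which carries the measure. -/
theorem exists_polynomial_eLpNorm_sub_le (hT : 0 ≤ T) (σ : SimpleFunc ℝ ℝ) {δ : ℝ} (hδ : 0 < δ) :
    ∃ p : Polynomial ℝ, eLpNorm ((fun t => p.eval t) - ⇑σ) 1 (timeMeasure T) ≤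
      (timeMeasure T univ + 1) * ENNReal.ofReal δ := by
  obtain ⟨φ, hφ, hφm⟩ := (σ.memLp_of_isFiniteMeasure 1
    (timeMeasure T)).exists_boundedContinuous_eLpNorm_sub_le ENNReal.one_ne_top
    (ε := ENNReal.ofReal δ) (by simpa using hδ)
  obtain ⟨p, hp⟩ := exists_polynomial_near_of_continuousOn 0 T φ φ.continuous.continuousOn δ hδ
  refine ⟨p, ?_⟩
  have h1 : eLpNorm ((fun t => p.eval t) - ⇑φ) 1 (timeMeasure T) ≤
      timeMeasure T univ * ENNReal.ofReal δ := by
    have := eLpNorm_le_of_ae_bound (p := 1) (f := (fun t => p.eval t) - ⇑φ)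
      (ae_timeMeasure_of_forall hT fun t ht => (hp t ht).le)
    simpa using this
  have h2 : (fun t => p.eval t) - (σ : ℝ → ℝ) = ((fun t => p.eval t) - ⇑φ) - (⇑σ - ⇑φ) := by abel
  rw [h2, add_mul, one_mul]
  refine (eLpNorm_sub_le ?_ ?_ le_rfl).trans (add_le_add h1 hφ)
  · exact (p.continuous.sub φ.continuous).aestronglyMeasurable
  · exact σ.aestronglyMeasurable.sub φ.continuous.aestronglyMeasurable

variable [NormedSpace ℝ E]

/-- Simple maps with values in a bounded connected open set are limits of `C¹` maps with values in
that set. -/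
theorem exists_contDiff_eLpNorm_sub_simpleFunc_lt (hT : 0 ≤ T) {S : Set E}
    (hS : IsOpen S) (hc : IsConnected S) (hb : Bornology.IsBounded S) (s : SimpleFunc ℝ E)
    (hs : ∀ t, s t ∈ S) {ε : ENNReal} (hε : 0 < ε) :
    ∃ v : ℝ → E, ContDiff ℝ 1 v ∧ (∀ t, v t ∈ S) ∧ eLpNorm (v - ⇑s) 1 (timeMeasure T) < ε := by
  obtain ⟨γ, hγ, hγS, hrange⟩ := exists_contDiff_curve_through hS hc s.finite_range
    (by rintro _ ⟨t, rfl⟩; exact hs t)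
  -- Writing `s = γ ∘ σ` with `σ` real-valued turns the constraint into a scalar problem: for any
  -- polynomial `p`, the map `γ ∘ p` stays in `S`.
  set σ : SimpleFunc ℝ ℝ := s.map (Function.invFun γ) with hσ
  have hγσ : ∀ t, γ (σ t) = s t := fun t => Function.invFun_eq (hrange ⟨t, rfl⟩)
  choose p hp using fun k : ℕ =>
    exists_polynomial_eLpNorm_sub_le hT σ (δ := 1 / ((k : ℝ) + 1)) (by positivity)
  have hlim : Tendsto (fun k : ℕ => eLpNorm ((fun t => (p k).eval t) - ⇑σ) 1 (timeMeasure T)) atTop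
      (𝓝 0) := by
    refine tendsto_of_tendsto_of_tendsto_of_le_of_le tendsto_const_nhds ?_ (fun _ => zero_le) hp
    have h1 := ENNReal.tendsto_ofReal (tendsto_one_div_add_atTop_nhds_zero_nat (𝕜 := ℝ))
    have h2 := ENNReal.Tendsto.const_mul (a := timeMeasure T univ + 1) h1
      (Or.inr (ENNReal.add_ne_top.2 ⟨measure_ne_top _ _, ENNReal.one_ne_top⟩))
    simpa using h2
  -- Continuity of `γ` transfers only pointwise convergence, hence the subsequence; boundedness of
  -- `S` then gives `L¹` convergence.
  obtain ⟨ns, -, hns⟩ := (tendstoInMeasure_of_tendsto_eLpNorm one_ne_zero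
    (fun k => (p k).continuous.aestronglyMeasurable) σ.aestronglyMeasurable
    hlim).exists_seq_tendsto_ae
  obtain ⟨C, hC⟩ := hb.exists_norm_le
  have h3 : Tendsto (fun k => eLpNorm ((fun t => γ ((p (ns k)).eval t)) - ⇑s) 1 (timeMeasure T))
      atTop (𝓝 0) := by
    refine tendsto_eLpNorm_one_of_bounded (C := C)
      (fun k => (hγ.continuous.comp (p (ns k)).continuous).aestronglyMeasurable)
      s.aestronglyMeasurable (fun k => ae_of_all _ fun t => hC _ (hγS _))
      (ae_of_all _ fun t => hC _ (hs t)) ?_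
    filter_upwards [hns] with t ht
    rw [← hγσ t]
    exact (hγ.continuous.tendsto _).comp ht
  obtain ⟨k, hk⟩ := (h3.eventually_lt_const hε).exists
  exact ⟨_, hγ.comp (by simpa using (p (ns k)).contDiff_aeval (𝕜 := ℝ) 1), fun t => hγS _, hk⟩

/-- Density of `C¹` controls: integrable maps with values in the closure of a bounded connected
open set `S` are limits in `L¹_{0}` of `C¹` maps with values in `S`. -/
theorem exists_contDiff_tendstoL1I [FiniteDimensional ℝ E] (hT : 0 ≤ T) {S : Set E}
    (hS : IsOpen S) (hc : IsConnected S) (hb : Bornology.IsBounded S) {u : ℝ → E}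
    (hu : MemL1I T {0} (closure S) u) :
    ∃ v : ℕ → ℝ → E, (∀ k, ContDiff ℝ 1 (v k)) ∧ (∀ k t, v k t ∈ S) ∧ TendstoL1I T {0} v u := by
  have : ProperSpace E := FiniteDimensional.proper ℝ E
  borelize E
  obtain ⟨hint, hmem⟩ := memL1I_zero_iff.1 hu
  have hum := aestronglyMeasurable_timeMeasure hint.aestronglyMeasurable
  set u' := hum.mk u with hu'
  have hu'm : Measurable u' := hum.stronglyMeasurable_mk.measurable
  have hu'mem : ∀ᵐ t ∂timeMeasure T, u' t ∈ closure S := by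
    filter_upwards [hmem, hum.ae_eq_mk] with t h1 h2
    rwa [hu', ← h2]
  obtain ⟨y₀, hy₀⟩ := hc.nonempty
  obtain ⟨C, hC⟩ := hb.closure.exists_norm_le
  -- The simple maps take values in `S` itself, although `u'` is only in its closure.
  have hlim := SimpleFunc.tendsto_approxOn_Lp_eLpNorm hu'm hy₀ ENNReal.one_ne_top hu'mem (by
    refine (eLpNorm_le_of_ae_bound (p := 1) (C := C + ‖y₀‖) ?_).trans_lt
      (ENNReal.mul_lt_top ?_ ENNReal.ofReal_lt_top)
    · filter_upwards [hu'mem] with t ht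
      exact (norm_sub_le _ _).trans (add_le_add_left (hC _ ht) _)
    · simp)
  have key : ∀ k : ℕ, ∃ v : ℝ → E, ContDiff ℝ 1 v ∧ (∀ t, v t ∈ S) ∧
      eLpNorm (v - u) 1 (timeMeasure T) ≤ ENNReal.ofReal (1 / ((k : ℝ) + 1)) := by
    intro k
    have hε : 0 < ENNReal.ofReal (1 / ((k : ℝ) + 1)) / 2 :=
      ENNReal.half_pos (by simpa using by positivity)
    obtain ⟨j, hj⟩ := (hlim.eventually_lt_const hε).exists
    set s := SimpleFunc.approxOn u' hu'm S y₀ hy₀ j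
    obtain ⟨v, hv, hvS, hvs⟩ := exists_contDiff_eLpNorm_sub_simpleFunc_lt hT hS hc hb s
      (fun t => SimpleFunc.approxOn_mem hu'm hy₀ j t) hε
    refine ⟨v, hv, hvS, ?_⟩
    have h1 : v - u =ᵐ[timeMeasure T] (v - ⇑s) + (⇑s - u') := by
      filter_upwards [hum.ae_eq_mk] with t ht
      simp [ht, hu']
    rw [eLpNorm_congr_ae h1, ← ENNReal.add_halves (ENNReal.ofReal _)]
    exact (eLpNorm_add_le (hv.continuous.aestronglyMeasurable.sub s.aestronglyMeasurable)
      (s.aestronglyMeasurable.sub hu'm.aestronglyMeasurable) le_rfl).trans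
      (add_le_add hvs.le hj.le)
  choose v hv hvS hvu using key
  refine ⟨v, hv, hvS, tendstoL1I_zero_iff.2 ?_⟩
  refine tendsto_of_tendsto_of_tendsto_of_le_of_le tendsto_const_nhds ?_ (fun _ => zero_le) hvu
  simpa using ENNReal.tendsto_ofReal (tendsto_one_div_add_atTop_nhds_zero_nat (𝕜 := ℝ))

end Approximation

end Impulsive

namespace Impulsive

/-! ### Limits in `L¹_{0}` and stability of the reduced equation. -/

section Limits

variable {E : Type*} [NormedAddCommGroup E] {T : ℝ}

theorem tendstoL1I_zero_iff_integral {y : ℕ → ℝ → E} {y' : ℝ → E}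
    (hy : ∀ k, Integrable (y k) (timeMeasure T)) (hy' : Integrable y' (timeMeasure T)) :
    TendstoL1I T {0} y y' ↔
      Tendsto (fun k => ∫ t, ‖y k t - y' t‖ ∂timeMeasure T) atTop (𝓝 0) := by
  have h : ∀ k, ∫ t, ‖y k t - y' t‖ ∂timeMeasure T =
      (eLpNorm (y k - y') 1 (timeMeasure T)).toReal := fun k => by
    rw [eLpNorm_one_eq_lintegral_enorm]
    exact integral_norm_eq_lintegral_enorm ((hy k).sub hy').aestronglyMeasurable
  simp_rw [tendstoL1I_zero_iff, h]
  rw [← ENNReal.toReal_zero, ENNReal.tendsto_toReal_iff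
    (fun k => (memLp_one_iff_integrable.2 ((hy k).sub hy')).2.ne) ENNReal.zero_ne_top]

theorem TendstoL1I.unique {y : ℕ → ℝ → E} {y' y'' : ℝ → E}
    (hy : ∀ k, Integrable (y k) (timeMeasure T)) (hy' : Integrable y' (timeMeasure T))
    (hy'' : Integrable y'' (timeMeasure T)) (h' : TendstoL1I T {0} y y')
    (h'' : TendstoL1I T {0} y y'') : EqI T {0} y' y'' := by
  rw [eqI_zero_iff]
  rw [tendstoL1I_zero_iff_integral hy hy'] at h'
  rw [tendstoL1I_zero_iff_integral hy hy''] at h''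
  have hle : ∀ k, ∫ t, ‖y' t - y'' t‖ ∂timeMeasure T ≤
      ∫ t, ‖y k t - y' t‖ ∂timeMeasure T + ∫ t, ‖y k t - y'' t‖ ∂timeMeasure T := by
    intro k
    have h1 : Integrable (fun t => ‖y k t - y' t‖) (timeMeasure T) := ((hy k).sub hy').norm
    have h2 : Integrable (fun t => ‖y k t - y'' t‖) (timeMeasure T) := ((hy k).sub hy'').norm
    rw [← integral_add h1 h2]
    refine integral_mono (hy'.sub hy'').norm (h1.add h2) fun t => ?_
    have : y' t - y'' t = (y k t - y'' t) - (y k t - y' t) := by abel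
    simp only [this]
    exact (norm_sub_le _ _).trans (by rw [add_comm])
  have h0 : ∫ t, ‖y' t - y'' t‖ ∂timeMeasure T ≤ 0 :=
    ge_of_tendsto' (by simpa using h'.add h'') hle
  have h1 := (integral_eq_zero_iff_of_nonneg (fun t => norm_nonneg _) (hy'.sub hy'').norm).1
    (le_antisymm h0 (integral_nonneg fun t => norm_nonneg _))
  filter_upwards [h1] with t ht
  exact sub_eq_zero.1 (norm_eq_zero.1 ht)

end Limits

variable {n m l : ℕ} {U : Set ℝ^[m]} {A : Set ℝ^[l]} {f : ℝ^[n] → ℝ^[m] → ℝ^[l] → ℝ^[n]}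
  {g : Fin m → ℝ^[n] → ℝ^[m] → ℝ^[n]} {P : ℝ^[n] × ℝ^[m] → ℝ^[n]}
  {Ψ : ℝ^[n] × ℝ^[m] → ℝ^[n] × ℝ^[m]} {T : ℝ} {a : ℝ → ℝ^[l]} {x₀ : ℝ^[n]}

/-- Measurable inputs on `[0,T]` with values in `U`, bounded by `C`. -/
structure IsBoundedInput (T : ℝ) (U : Set ℝ^[m]) (C : ℝ) (u : ℝ → ℝ^[m]) : Prop where
  aestronglyMeasurable : AEStronglyMeasurable u (volume.restrict (Icc 0 T))
  bound : ∀ᵐ t ∂timeMeasure T, ‖u t‖ ≤ C ∧ u t ∈ U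

theorem IsBoundedInput.integrable {C : ℝ} {u : ℝ → ℝ^[m]} (h : IsBoundedInput T U C u) :
    Integrable u (timeMeasure T) :=
  (integrable_const C).mono' (aestronglyMeasurable_timeMeasure h.aestronglyMeasurable)
    (h.bound.mono fun _ ht => ht.1)

theorem IsBoundedInput.mono {C C' : ℝ} {u : ℝ → ℝ^[m]} (h : IsBoundedInput T U C u)
    (hC : C ≤ C') : IsBoundedInput T U C' u :=
  ⟨h.aestronglyMeasurable, h.bound.mono fun _ ht => ⟨ht.1.trans hC, ht.2⟩⟩

theorem IsC1Control.isBoundedInput (hT : 0 ≤ T) {v : ℝ → ℝ^[m]} (hv : IsC1Control T U v) {C : ℝ}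
    (hC : ∀ t ∈ Icc 0 T, ‖v t‖ ≤ C) : IsBoundedInput T U C v :=
  ⟨hv.1.continuousOn.aestronglyMeasurable measurableSet_Icc,
    ae_timeMeasure_of_forall hT fun t ht => ⟨hC t ht, hv.2 ht⟩⟩

/-- Solutions on `[0,T]` of the equation in straightened coordinates, truncated by means of `ρ`. -/
structure IsReducedSolution (T : ℝ) (f : ℝ^[n] → ℝ^[m] → ℝ^[l] → ℝ^[n])
    (P : ℝ^[n] × ℝ^[m] → ℝ^[n]) (Ψ : ℝ^[n] × ℝ^[m] → ℝ^[n] × ℝ^[m]) (x₀ : ℝ^[n])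
    (ρ : ℝ^[n] → ℝ^[n]) (u : ℝ → ℝ^[m]) (a : ℝ → ℝ^[l]) (y : ℝ → ℝ^[n]) : Prop where
  continuousOn : ContinuousOn y (Icc 0 T)
  eq_integral : ∀ t ∈ Icc 0 T, y t = P (x₀, u 0) +
    ∫ s in (0 : ℝ)..t, reducedField f P Ψ (a s) (ρ (y s), u s)

theorem IsReducedSolution.integrableOn (hf : IsRegularDrift U A f) (h : IsRectification g P Ψ)
    (ha : MemL1I T ∅ A a) {C : ℝ} {ρ : ℝ^[n] → ℝ^[n]} (hρ : LipschitzWith 1 ρ) {u : ℝ → ℝ^[m]}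
    (hu : IsBoundedInput T U C u) {y : ℝ → ℝ^[n]} (hy : ContinuousOn y (Icc 0 T))
    (hyC : ∀ t ∈ Icc 0 T, ‖ρ (y t)‖ ≤ C) :
    IntegrableOn (fun s => reducedField f P Ψ (a s) (ρ (y s), u s)) (Icc 0 T) :=
  hf.integrableOn_reducedField h ha
    ((hρ.continuous.comp_continuousOn hy).aestronglyMeasurable measurableSet_Icc)
    hu.aestronglyMeasurable ((ae_restrict_iff' measurableSet_Icc).2 (ae_of_all _ hyC))
    (ae_timeMeasure_iff.1 hu.bound).2

theorem IsReducedSolution.congr_id {ρ : ℝ^[n] → ℝ^[n]} {u : ℝ → ℝ^[m]} {y : ℝ → ℝ^[n]}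
    (h : IsReducedSolution T f P Ψ x₀ ρ u a y) (hρ : ∀ t ∈ Icc 0 T, ρ (y t) = y t) :
    IsReducedSolution T f P Ψ x₀ id u a y := by
  refine ⟨h.continuousOn, fun t ht => (h.eq_integral t ht).trans ?_⟩
  congr 1
  refine intervalIntegral.integral_congr fun s hs => ?_
  rw [uIcc_of_le ht.1] at hs
  simp only [hρ s ⟨hs.1, hs.2.trans ht.2⟩, id_eq]

/-- Reduced solutions depend in a Lipschitz way on the input, in the norm of `L¹_{0}`. -/
theorem exists_norm_sub_le_of_isReducedSolution (hT : 0 ≤ T) (hf : IsRegularDrift U A f)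
    (h : IsRectification g P Ψ) (ha : MemL1I T ∅ A a) (x₀ : ℝ^[n]) (C : ℝ) :
    ∃ K ≥ 0, ∀ (ρ : ℝ^[n] → ℝ^[n]) (u₁ u₂ : ℝ → ℝ^[m]) (y₁ y₂ : ℝ → ℝ^[n]), LipschitzWith 1 ρ →
      IsBoundedInput T U C u₁ → IsBoundedInput T U C u₂ →
      IsReducedSolution T f P Ψ x₀ ρ u₁ a y₁ → IsReducedSolution T f P Ψ x₀ ρ u₂ a y₂ →
      (∀ t ∈ Icc 0 T, ‖ρ (y₁ t)‖ ≤ C) → (∀ t ∈ Icc 0 T, ‖ρ (y₂ t)‖ ≤ C) →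
      ∀ t ∈ Icc 0 T, ‖y₁ t - y₂ t‖ ≤ K * ∫ s, ‖u₁ s - u₂ s‖ ∂timeMeasure T := by
  obtain ⟨L, hL, M, hLM⟩ := hf.exists_lipschitz_reducedField h C
  obtain ⟨L', hL'⟩ := (h.contDiff.of_le one_le_two).contDiffOn.exists_lipschitzOnWith
    (s := Metric.closedBall 0 (max ‖x₀‖ C)) one_ne_zero (convex_closedBall _ _)
    (isCompact_closedBall _ _)
  -- `L'` accounts for the initial states `P (x₀, uᵢ 0)`, `L` for the inputs inside the integral,
  -- and the exponential is Grönwall's.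
  refine ⟨(L' + L) * Real.exp (L * T), by positivity, ?_⟩
  intro ρ u₁ u₂ y₁ y₂ hρ hu₁ hu₂ hy₁ hy₂ hC₁ hC₂ t ht
  have hu := hu₁.integrable.sub hu₂.integrable
  have huT : IntegrableOn (u₁ - u₂) (Icc 0 T) := hu.mono_measure (Measure.le_add_right le_rfl)
  obtain ⟨hu₁0, hu₁b⟩ := ae_timeMeasure_iff.1 hu₁.bound
  obtain ⟨hu₂0, hu₂b⟩ := ae_timeMeasure_iff.1 hu₂.bound
  have key := norm_sub_le_of_integral_curves hT hL
    (IsReducedSolution.integrableOn hf h ha hρ hu₁ hy₁.continuousOn hC₁)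
    (IsReducedSolution.integrableOn hf h ha hρ hu₂ hy₂.continuousOn hC₂)
    hy₁.eq_integral hy₂.eq_integral
    (e := fun s => L * ‖u₁ s - u₂ s‖) (huT.norm.const_mul L) (fun s => by positivity) (by
      filter_upwards [hu₁b, hu₂b, ha.2.2, ae_restrict_mem measurableSet_Icc] with s h1 h2 h3 hs
      refine ((hLM _ h3 _ ⟨?_, trivial, h1.2⟩).2 _ ⟨?_, trivial, h2.2⟩).trans ?_
      · simpa [Prod.norm_def] using ⟨hC₁ s hs, h1.1⟩
      · simpa [Prod.norm_def] using ⟨hC₂ s hs, h2.1⟩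
      · rw [← mul_add]
        refine mul_le_mul_of_nonneg_left ?_ hL
        rw [Prod.mk_sub_mk, Prod.norm_def]
        refine max_le ?_ (le_add_of_nonneg_left (norm_nonneg _))
        have := hρ.norm_sub_le (y₁ s) (y₂ s)
        rw [NNReal.coe_one, one_mul] at this
        exact this.trans (le_add_of_nonneg_right (norm_nonneg _))) t ht
  refine key.trans ?_
  have h0 : ‖P (x₀, u₁ 0) - P (x₀, u₂ 0)‖ ≤ L' * ‖u₁ 0 - u₂ 0‖ := by
    have := hL'.norm_sub_le (x := (x₀, u₁ 0)) (y := (x₀, u₂ 0))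
      (mem_closedBall_zero_iff.2 (max_le_max le_rfl hu₁0.1))
      (mem_closedBall_zero_iff.2 (max_le_max le_rfl hu₂0.1))
    simpa [Prod.norm_def] using this
  have h1 : ∫ s, ‖u₁ s - u₂ s‖ ∂timeMeasure T =
      (∫ s in Icc 0 T, ‖u₁ s - u₂ s‖) + ‖u₁ 0 - u₂ 0‖ := by
    have huT' : IntegrableOn (fun s => ‖u₁ s - u₂ s‖) (Icc 0 T) := huT.norm
    rw [timeMeasure, integral_add_measure huT' (integrable_dirac (by simp)), integral_dirac]
  rw [integral_const_mul, h1, mul_right_comm]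
  refine mul_le_mul_of_nonneg_right ?_ (Real.exp_nonneg _)
  have h2 : 0 ≤ ∫ s in Icc 0 T, ‖u₁ s - u₂ s‖ := integral_nonneg fun _ => norm_nonneg _
  nlinarith [mul_nonneg hL (norm_nonneg (u₁ 0 - u₂ 0)), mul_nonneg L'.coe_nonneg h2]

/-- Convergence of the inputs implies that of the reduced solutions, and of the corresponding
curves in the original coordinates. -/
theorem tendsto_of_isReducedSolution (hT : 0 ≤ T) (hf : IsRegularDrift U A f)
    (h : IsRectification g P Ψ) (ha : MemL1I T ∅ A a) {C : ℝ} {ρ : ℝ^[n] → ℝ^[n]}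
    (hρ : LipschitzWith 1 ρ) {v : ℕ → ℝ → ℝ^[m]} {y : ℕ → ℝ → ℝ^[n]} {u : ℝ → ℝ^[m]}
    {y' : ℝ → ℝ^[n]} (hv : ∀ k, IsBoundedInput T U C (v k)) (hu : IsBoundedInput T U C u)
    (hy : ∀ k, IsReducedSolution T f P Ψ x₀ ρ (v k) a (y k))
    (hy' : IsReducedSolution T f P Ψ x₀ ρ u a y')
    (hρy : ∀ k, ∀ t ∈ Icc 0 T, ‖ρ (y k t)‖ ≤ C) (hρy' : ∀ t ∈ Icc 0 T, ‖ρ (y' t)‖ ≤ C)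
    (hyC : ∀ k, ∀ t ∈ Icc 0 T, ‖y k t‖ ≤ C) (hyC' : ∀ t ∈ Icc 0 T, ‖y' t‖ ≤ C)
    (hlim : TendstoL1I T {0} v u) :
    (∀ t ∈ Icc 0 T, Tendsto (fun k => y k t) atTop (𝓝 (y' t))) ∧
      (∀ k, Integrable (fun t => Ψ (y k t, v k t)) (timeMeasure T)) ∧
      Integrable (fun t => Ψ (y' t, u t)) (timeMeasure T) ∧
      TendstoL1I T {0} (fun k t => Ψ (y k t, v k t)) fun t => Ψ (y' t, u t) := by
  obtain ⟨K, hK, hle⟩ := exists_norm_sub_le_of_isReducedSolution hT hf h ha x₀ C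
  have hΨ1 : ContDiff ℝ 1 Ψ := h.contDiff_symm.of_le one_le_two
  obtain ⟨L, hL⟩ := hΨ1.contDiffOn.exists_lipschitzOnWith (s := Metric.closedBall 0 C)
    one_ne_zero (convex_closedBall _ _) (isCompact_closedBall _ _)
  obtain ⟨M, hM⟩ := (isCompact_closedBall (0 : ℝ^[n] × ℝ^[m]) C).exists_bound_of_continuousOn
    hΨ1.continuous.continuousOn
  have hball : ∀ {w : ℝ → ℝ^[m]} {z : ℝ → ℝ^[n]}, IsBoundedInput T U C w →
      (∀ t ∈ Icc 0 T, ‖z t‖ ≤ C) →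
      ∀ᵐ t ∂timeMeasure T, (z t, w t) ∈ Metric.closedBall (0 : ℝ^[n] × ℝ^[m]) C := by
    intro w z hw hz
    filter_upwards [hw.bound, ae_timeMeasure_of_forall hT hz] with t h1 h2
    simpa [Prod.norm_def] using ⟨h2, h1.1⟩
  have hint : ∀ {w : ℝ → ℝ^[m]} {z : ℝ → ℝ^[n]}, IsBoundedInput T U C w →
      ContinuousOn z (Icc 0 T) → (∀ t ∈ Icc 0 T, ‖z t‖ ≤ C) →
      Integrable (fun t => Ψ (z t, w t)) (timeMeasure T) := by
    intro w z hw hzc hz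
    refine (integrable_const M).mono' ?_ ((hball hw hz).mono fun t ht => hM _ ht)
    exact hΨ1.continuous.comp_aestronglyMeasurable (aestronglyMeasurable_timeMeasure
      ((hzc.aestronglyMeasurable measurableSet_Icc).prodMk hw.aestronglyMeasurable))
  have hI := fun k => hint (hv k) (hy k).continuousOn (hyC k)
  have hI' := hint hu hy'.continuousOn hyC'
  rw [tendstoL1I_zero_iff_integral (fun k => (hv k).integrable) hu.integrable] at hlim
  have hdiff := fun k => hle ρ (v k) u (y k) y' hρ (hv k) hu (hy k) hy' (hρy k) hρy'
  refine ⟨fun t ht => ?_, hI, hI', ?_⟩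
  · rw [tendsto_iff_norm_sub_tendsto_zero]
    exact squeeze_zero (fun _ => norm_nonneg _) (fun k => hdiff k t ht)
      (by simpa using hlim.const_mul K)
  rw [tendstoL1I_zero_iff_integral hI hI']
  have hbd : ∀ k, ∫ t, ‖Ψ (y k t, v k t) - Ψ (y' t, u t)‖ ∂timeMeasure T ≤
      L * (K * (∫ s, ‖v k s - u s‖ ∂timeMeasure T) * (timeMeasure T).real univ +
        ∫ s, ‖v k s - u s‖ ∂timeMeasure T) := by
    intro k
    have hvu : Integrable (fun t => ‖v k t - u t‖) (timeMeasure T) :=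
      ((hv k).integrable.sub hu.integrable).norm
    have h1 : ∫ t, L * (K * (∫ s, ‖v k s - u s‖ ∂timeMeasure T) + ‖v k t - u t‖) ∂timeMeasure T =
        L * (K * (∫ s, ‖v k s - u s‖ ∂timeMeasure T) * (timeMeasure T).real univ +
        ∫ s, ‖v k s - u s‖ ∂timeMeasure T) := by
      rw [integral_const_mul, integral_add (integrable_const _) hvu, integral_const, smul_eq_mul,
        mul_comm (Measure.real _ _)]
    rw [← h1]
    refine integral_mono_ae ((hI k).sub hI').norm
      (((integrable_const _).add hvu).const_mul _) ?_
    filter_upwards [hball (hv k) (hyC k), hball hu hyC',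
      ae_timeMeasure_of_forall hT (hdiff k)] with t h2 h3 h4
    refine (hL.norm_sub_le h2 h3).trans (mul_le_mul_of_nonneg_left ?_ L.coe_nonneg)
    rw [Prod.mk_sub_mk, Prod.norm_def]
    refine max_le (h4.trans (le_add_of_nonneg_right (norm_nonneg _))) ?_
    exact le_add_of_nonneg_left
      (mul_nonneg hK (integral_nonneg fun _ => norm_nonneg _))
  refine squeeze_zero (fun _ => integral_nonneg fun _ => norm_nonneg _) hbd ?_
  have := (((hlim.const_mul K).mul_const ((timeMeasure T).real univ)).add hlim).const_mul (L : ℝ)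
  simpa using this

/-- The truncated reduced equation can be solved for every bounded input. -/
theorem exists_isReducedSolution (hT : 0 ≤ T) (hf : IsRegularDrift U A f)
    (h : IsRectification g P Ψ) (ha : MemL1I T ∅ A a) (x₀ : ℝ^[n]) {C : ℝ} {ρ : ℝ^[n] → ℝ^[n]}
    (hρ : LipschitzWith 1 ρ) (hρC : ∀ y, ‖ρ y‖ ≤ C) {u : ℝ → ℝ^[m]}
    (hu : IsBoundedInput T U C u) : ∃ y, IsReducedSolution T f P Ψ x₀ ρ u a y := by
  obtain ⟨L, hL, M, hLM⟩ := hf.exists_lipschitz_reducedField h C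
  obtain ⟨y, hyc, hy⟩ := exists_caratheodory_solution hT
    (F := fun t y => reducedField f P Ψ (a t) (ρ y, u t)) hL (by
      -- As `ρ` maps into the ball of radius `C`, the local Lipschitz constant holds for all states.
      filter_upwards [(ae_timeMeasure_iff.1 hu.bound).2, ha.2.2] with t h1 h2 y y'
      refine ((hLM _ h2 _ ⟨?_, trivial, h1.2⟩).2 _ ⟨?_, trivial, h1.2⟩).trans ?_
      · simpa [Prod.norm_def] using ⟨hρC y, h1.1⟩
      · simpa [Prod.norm_def] using ⟨hρC y', h1.1⟩
      · refine mul_le_mul_of_nonneg_left ?_ hL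
        simpa [Prod.norm_def] using hρ.norm_sub_le y y')
    (fun y hy => IsReducedSolution.integrableOn hf h ha hρ hu hy.continuousOn fun t _ => hρC _)
    (P (x₀, u 0))
  exact ⟨y, hyc.continuousOn, hy⟩

/-- Bounded inputs give bounded reduced solutions, so that the truncation is inactive for controls
of class `C¹`. -/
theorem exists_bound_isReducedSolution (hT : 0 ≤ T) (hf : IsRegularDrift U A f)
    (h : IsRectification g P Ψ) (ha : MemL1I T ∅ A a)
    (hbound : BoundedInputBoundedState T U A f g) (x₀ : ℝ^[n]) (C : ℝ) :
    ∃ N : ℝ, ∀ (ρ : ℝ^[n] → ℝ^[n]) (D : ℝ) (v : ℝ → ℝ^[m]) (y : ℝ → ℝ^[n]), LipschitzWith 1 ρ →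
      (∀ z, ‖ρ z‖ ≤ D) → (∀ z, ‖z‖ ≤ N + 1 → ρ z = z) → IsC1Control T U v →
      (∀ t ∈ Icc 0 T, ‖v t‖ ≤ C) → IsReducedSolution T f P Ψ x₀ ρ v a y →
      (∀ t ∈ Icc 0 T, ‖y t‖ ≤ N) ∧ IsSolution T f g x₀ v a T fun t => Ψ (y t, v t) := by
  obtain ⟨N₀, hN₀⟩ := hbound (‖x₀‖ + C)
  -- `N₀` bounds the `x`-component of true solutions, and `N` bounds `P` at the corresponding
  -- states.
  obtain ⟨N, hN⟩ := (isCompact_closedBall (0 : ℝ^[n] × ℝ^[m])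
    (max N₀ C)).exists_bound_of_continuousOn h.contDiff.continuous.continuousOn
  refine ⟨N, fun ρ D v y hρ hρD hρN hv hvC hy => ?_⟩
  have hint := (IsReducedSolution.integrableOn hf h ha hρ
    ((hv.isBoundedInput hT hvC).mono (le_max_left C D)) hy.continuousOn
    fun t _ => (hρD _).trans (le_max_right C D))
  -- Bootstrap: as long as `‖y‖ ≤ N + 1` the truncation is inactive, `Ψ (y, v)` is a true solution,
  -- and the bound improves to `N`.
  have key : ∀ τ ∈ Icc 0 T, (∀ t ∈ Icc 0 τ, ‖y t‖ ≤ N + 1) →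
      IsSolution T f g x₀ v a τ (fun t => Ψ (y t, v t)) ∧ ∀ t ∈ Icc 0 τ, ‖y t‖ ≤ N := by
    intro τ hτ hyτ
    have hsol : IsSolution T f g x₀ v a τ (fun t => Ψ (y t, v t)) := by
      refine h.isSolution hτ hv ?_ fun t ht => ?_
      · refine (hint.intervalIntegrable_zero hτ).congr fun s hs => ?_
        rw [uIoc_of_le hτ.1] at hs
        simp only [hρN _ (hyτ s ⟨hs.1.le, hs.2⟩)]
      · refine (hy.eq_integral t ⟨ht.1, ht.2.trans hτ.2⟩).trans ?_
        congr 1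
        refine intervalIntegral.integral_congr fun s hs => ?_
        rw [uIcc_of_le ht.1] at hs
        simp only [hρN _ (hyτ s ⟨hs.1, hs.2.trans ht.2⟩)]
    refine ⟨hsol, fun t ht => ?_⟩
    have h1 := hN₀ x₀ v a τ _ hv ha hτ (fun t ht => by linarith [hvC t ht]) hsol t ht
    have h2 := hN (Ψ (y t, v t)) (by
      rw [mem_closedBall_zero_iff, Prod.norm_def]
      refine max_le_max h1 ?_
      rw [h.symm_snd]
      exact hvC t ⟨ht.1, ht.2.trans hτ.2⟩)
    rwa [h.apply_symm] at h2
  have hlt : ∀ t ∈ Icc 0 T, ‖y t‖ ≤ N + 1 := by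
    by_contra! hcon
    obtain ⟨t₁, ht₁, hlt⟩ := hcon
    have hcn : ContinuousOn (fun t => ‖y t‖) (Icc 0 T) := hy.continuousOn.norm
    have hcompact : IsCompact (Icc 0 T ∩ (fun t => ‖y t‖) ⁻¹' Ici (N + 1)) :=
      isCompact_Icc.of_isClosed_subset (hcn.preimage_isClosed_of_isClosed isClosed_Icc
        isClosed_Ici) inter_subset_left
    obtain ⟨τ, ⟨hτ, hτN⟩, hmin⟩ := hcompact.exists_isLeast ⟨t₁, ht₁, hlt.le⟩
    simp only [mem_preimage, mem_Ici] at hτN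
    have hbefore : ∀ t ∈ Ico 0 τ, ‖y t‖ < N + 1 := by
      intro t ht
      by_contra! hc
      exact absurd (hmin ⟨⟨ht.1, ht.2.le.trans hτ.2⟩, hc⟩) (not_le.2 ht.2)
    have hle : ∀ t ∈ Icc 0 τ, ‖y t‖ ≤ N + 1 := by
      have hsub : Icc 0 τ ⊆ Icc 0 T := Icc_subset_Icc_right hτ.2
      rcases hτ.1.eq_or_lt with h0 | h0
      · intro t ht
        have ht0 : t = 0 := le_antisymm (ht.2.trans h0.ge) ht.1
        subst ht0
        have h0T : (0 : ℝ) ∈ Icc 0 T := ⟨le_rfl, hT⟩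
        -- If the level `N + 1` is reached at time `0`, the initial state is bounded by means of the
        -- trivial solution on `[0, 0]`.
        have hs0 : IsSolution T f g x₀ v a 0 fun _ => (x₀, v 0) :=
          ⟨by simp, fun t ht => by
            rw [le_antisymm ht.2 ht.1, intervalIntegral.integral_same, add_zero]⟩
        have h1 := hN₀ x₀ v a 0 _ hv ha h0T (fun t ht => by linarith [hvC t ht]) hs0 0 (by simp)
        have h2 := hN (x₀, v 0) (by
          rw [mem_closedBall_zero_iff, Prod.norm_def]
          exact max_le_max h1 (hvC 0 h0T))
        rw [hy.eq_integral 0 h0T, intervalIntegral.integral_same, add_zero]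
        linarith
      · intro t ht
        refine ContinuousWithinAt.closure_le (s := Ico 0 τ) (g := fun _ => N + 1) ?_
          ((hcn t (hsub ht)).mono (Ico_subset_Icc_self.trans hsub)) continuousWithinAt_const
          (fun y hy => (hbefore y hy).le)
        rwa [closure_Ico h0.ne]
    linarith [(key τ hτ hle).2 τ ⟨hτ.1, le_rfl⟩]
  have hTT : T ∈ Icc 0 T := ⟨hT, le_rfl⟩
  exact ⟨(key T hTT hlt).2, (key T hTT hlt).1⟩

end Impulsive

/-! ### Existence and uniqueness of the generalized solution. -/

namespace Impulsive

variable {n m l : ℕ} {U : Set ℝ^[m]} {A : Set ℝ^[l]} {f : ℝ^[n] → ℝ^[m] → ℝ^[l] → ℝ^[n]}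
  {g : Fin m → ℝ^[n] → ℝ^[m] → ℝ^[n]} {P : ℝ^[n] × ℝ^[m] → ℝ^[n]}
  {Ψ : ℝ^[n] × ℝ^[m] → ℝ^[n] × ℝ^[m]} {T : ℝ} {a : ℝ → ℝ^[l]} {x₀ : ℝ^[n]}

/-- Along a bounded sequence of solutions, convergence of the controls to `u` determines the limit
of the states. -/
theorem eqI_of_isGeneralizedSolution (hT : 0 ≤ T) (hf : IsRegularDrift U A f)
    (h : IsRectification g P Ψ) (ha : MemL1I T ∅ A a) {C : ℝ} {u : ℝ → ℝ^[m]}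
    (hu : IsBoundedInput T U C u) {y : ℝ → ℝ^[n]}
    (hy : IsReducedSolution T f P Ψ x₀ id u a y) {w : ℝ → ℝ^[n] × ℝ^[m]}
    (hw : IsGeneralizedSolution T {0} U f g x₀ u a w) : EqI T {0} w fun t => Ψ (y t, u t) := by
  obtain ⟨hwL, v, W, hv, hW, ⟨D, hD⟩, hWw, hvu⟩ := hw
  obtain ⟨B, hB⟩ := isCompact_Icc.exists_bound_of_continuousOn hy.continuousOn
  obtain ⟨B', hB'⟩ := (isCompact_closedBall (0 : ℝ^[n] × ℝ^[m]) D).exists_bound_of_continuousOn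
    h.contDiff.continuous.continuousOn
  set C' := max (max C D) (max B B') with hC'
  have hCC' : C ≤ C' := (le_max_left _ _).trans (le_max_left _ _)
  have hDC' : D ≤ C' := (le_max_right _ _).trans (le_max_left _ _)
  have hBC' : B ≤ C' := (le_max_left _ _).trans (le_max_right _ _)
  have hB'C' : B' ≤ C' := (le_max_right _ _).trans (le_max_right _ _)
  have hred := fun k => (hW k).reduced hT h (hv k)
  have hWc : ∀ k, ContinuousOn (W k) (Icc 0 T) := fun k =>
    continuousOn_of_eq_integral hT (hW k).1 (hW k).2
  -- The controls are bounded because they are the `z`-components of the uniformly bounded states.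
  have hvb : ∀ k, IsBoundedInput T U C' (v k) := fun k =>
    (hv k).isBoundedInput hT fun t ht => by
      rw [← (hred k).1 t ht]
      exact ((norm_snd_le _).trans (hD k t ht)).trans hDC'
  have hy' : ∀ k, IsReducedSolution T f P Ψ x₀ id (v k) a fun t => P (W k t) := fun k =>
    ⟨h.contDiff.continuous.comp_continuousOn (hWc k), (hred k).2⟩
  have hyb : ∀ k, ∀ t ∈ Icc 0 T, ‖P (W k t)‖ ≤ C' := fun k t ht =>
    (hB' _ (by simpa using hD k t ht)).trans hB'C'
  have hyb' : ∀ t ∈ Icc 0 T, ‖y t‖ ≤ C' := fun t ht => (hB t ht).trans hBC'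
  obtain ⟨-, hI, hI', hlim⟩ := tendsto_of_isReducedSolution hT hf h ha LipschitzWith.id hvb
    (hu.mono hCC') hy' hy hyb hyb' hyb hyb' hvu
  have hWeq : ∀ k, W k =ᵐ[timeMeasure T] fun t => Ψ (P (W k t), v k t) := fun k =>
    ae_timeMeasure_of_forall hT fun t ht => by
      simp only [← (hred k).1 t ht, h.symm_apply]
  have hlim' : TendstoL1I T {0} W fun t => Ψ (y t, u t) := by
    rw [tendstoL1I_zero_iff] at hlim ⊢
    refine hlim.congr fun k => eLpNorm_congr_ae ?_
    filter_upwards [hWeq k] with t ht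
    simp only [Pi.sub_apply, ← ht]
  have hwI : Integrable w (timeMeasure T) :=
    integrable_add_measure.2 ⟨hwL.1, integrable_dirac (by simp)⟩
  exact hWw.unique (fun k => (hI k).congr (hWeq k).symm) hwI hI' hlim'

/-- The truncation level is fixed by `C¹` controls with values in `Ω`, for which the bounded-input
assumption speaks. The solution for `u` is then a limit of theirs. -/
theorem exists_unique_generalizedSolution (hT : 0 ≤ T) (hf : IsRegularDrift U A f)
    (h : IsRectification g P Ψ) (ha : MemL1I T ∅ A a)
    (hbound : BoundedInputBoundedState T U A f g) {Ω : Set ℝ^[m]} (hΩ : IsOpen Ω)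
    (hΩc : IsConnected Ω) (hΩb : Bornology.IsBounded Ω) (hΩU : Ω ⊆ U) {u : ℝ → ℝ^[m]}
    (hu : MemL1I T {0} U u) (huΩ : MemL1I T {0} (closure Ω) u) :
    ∃ ξ : ℝ → ℝ^[n], MemL1I T {0} univ ξ ∧
      IsGeneralizedSolution T {0} U f g x₀ u a (fun t => (ξ t, u t)) ∧
      ∀ w : ℝ → ℝ^[n] × ℝ^[m], IsGeneralizedSolution T {0} U f g x₀ u a w →
        EqI T {0} w (fun t => (ξ t, u t)) := by
  obtain ⟨C, hC⟩ := hΩb.closure.exists_norm_le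
  obtain ⟨v, hv, hvΩ, hvu⟩ := exists_contDiff_tendstoL1I hT hΩ hΩc hΩb huΩ
  have hvC : ∀ k t, ‖v k t‖ ≤ C := fun k t => hC _ (subset_closure (hvΩ k t))
  have hvU : ∀ k, IsC1Control T U (v k) := fun k =>
    ⟨(hv k).contDiffOn, fun t _ => hΩU (hvΩ k t)⟩
  have hub : IsBoundedInput T U C u := by
    refine ⟨hu.1.aestronglyMeasurable, ?_⟩
    filter_upwards [(memL1I_zero_iff.1 hu).2, (memL1I_zero_iff.1 huΩ).2] with t h1 h2
    exact ⟨hC _ h2, h1⟩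
  have hvb : ∀ k, IsBoundedInput T U C (v k) := fun k =>
    (hvU k).isBoundedInput hT fun t _ => hvC k t
  obtain ⟨N, hN⟩ := exists_bound_isReducedSolution hT hf h ha hbound x₀ C
  obtain ⟨ρ, D, hρ, hρD, hρN⟩ := exists_retraction (ι := Fin n) (N + 1)
  have hCD : C ≤ max C D := le_max_left _ _
  have hρCD : ∀ z, ‖ρ z‖ ≤ max C D := fun z => (hρD z).trans (le_max_right _ _)
  obtain ⟨y, hy⟩ := exists_isReducedSolution hT hf h ha x₀ hρ hρCD (hub.mono hCD)
  choose z hz using fun k =>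
    exists_isReducedSolution hT hf h ha x₀ hρ hρCD ((hvb k).mono hCD)
  have hzN := fun k => hN ρ D (v k) (z k) hρ hρD hρN (hvU k) (fun t _ => hvC k t) (hz k)
  obtain ⟨B, hB⟩ := isCompact_Icc.exists_bound_of_continuousOn hy.continuousOn
  set C' := max (max C D) (max B N) with hC'
  have hρC' : ∀ z, ‖ρ z‖ ≤ C' := fun z => (hρCD z).trans (le_max_left _ _)
  have hCC' : C ≤ C' := hCD.trans (le_max_left _ _)
  have hyC' : ∀ t ∈ Icc 0 T, ‖y t‖ ≤ C' := fun t ht =>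
    (hB t ht).trans ((le_max_left _ _).trans (le_max_right _ _))
  have hzC' : ∀ k, ∀ t ∈ Icc 0 T, ‖z k t‖ ≤ C' := fun k t ht =>
    ((hzN k).1 t ht).trans ((le_max_right _ _).trans (le_max_right _ _))
  obtain ⟨hzy, -, hI', hlim⟩ := tendsto_of_isReducedSolution hT hf h ha hρ
    (fun k => (hvb k).mono hCC') (hub.mono hCC') hz hy (fun _ _ _ => hρC' _) (fun _ _ => hρC' _)
    hzC' hyC' hvu
  -- The assumption on bounded inputs says nothing about `u` itself; its bound is inherited by
  -- pointwise convergence and removes the truncation.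
  have hyN : ∀ t ∈ Icc 0 T, ‖y t‖ ≤ N := fun t ht =>
    le_of_tendsto' (hzy t ht).norm fun k => (hzN k).1 t ht
  have hyid : IsReducedSolution T f P Ψ x₀ id u a y :=
    hy.congr_id fun t ht => hρN _ (by linarith [hyN t ht])
  have hpair : (fun t => ((Ψ (y t, u t)).1, u t)) = fun t => Ψ (y t, u t) :=
    funext fun t => Prod.ext rfl (h.symm_snd (y t, u t)).symm
  have hIT : IntegrableOn (fun t => Ψ (y t, u t)) (Icc 0 T) :=
    hI'.mono_measure (Measure.le_add_right le_rfl)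
  refine ⟨fun t => (Ψ (y t, u t)).1, memL1I_zero_iff.2 ⟨hIT.fst, by simp⟩, ?_, ?_⟩
  · rw [hpair]
    refine ⟨memL1I_zero_iff.2 ⟨hIT, ?_⟩, v, fun k t => Ψ (z k t, v k t), hvU,
      fun k => (hzN k).2, ?_, hlim, hvu⟩
    · filter_upwards [hub.bound] with t ht
      exact ⟨trivial, by rw [h.symm_snd]; exact ht.2⟩
    · obtain ⟨M, hM⟩ := (isCompact_closedBall (0 : ℝ^[n] × ℝ^[m]) C').exists_bound_of_continuousOn
        h.contDiff_symm.continuous.continuousOn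
      exact ⟨M, fun k t ht => hM _ (by
        rw [mem_closedBall_zero_iff]
        exact max_le (hzC' k t ht) ((hvC k t).trans hCC'))⟩
  · intro w hw
    rw [hpair]
    exact eqI_of_isGeneralizedSolution hT hf h ha hub hyid hw

end Impulsive

theorem mainTheorem7 (n m l : ℕ) (T : ℝ) (hT : 0 < T)
    (U : Set (EuclideanSpace ℝ (Fin m))) (A : Set (EuclideanSpace ℝ (Fin l)))
    (f : EuclideanSpace ℝ (Fin n) → EuclideanSpace ℝ (Fin m) → EuclideanSpace ℝ (Fin l) →
      EuclideanSpace ℝ (Fin n))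
    (g : Fin m → EuclideanSpace ℝ (Fin n) → EuclideanSpace ℝ (Fin m) → EuclideanSpace ℝ (Fin n))
    -- the fields `g_α` are `C²`, complete and commute
    (hg : ∀ α, ContDiff ℝ 2 (Impulsive.field g α))
    (hcomplete : ∀ α p, ∃ γ : ℝ → EuclideanSpace ℝ (Fin n) × EuclideanSpace ℝ (Fin m),
      γ 0 = p ∧ ∀ t, HasDerivAt γ (Impulsive.field g α (γ t)) t)
    (hcomm : ∀ α β p,
      VectorField.lieBracket ℝ (Impulsive.field g α) (Impulsive.field g β) p = 0)
    -- the control sets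
    (hU : ∃ Ω : Set (EuclideanSpace ℝ (Fin m)), IsOpen Ω ∧ IsConnected Ω ∧ U = closure Ω)
    (hA : IsCompact A)
    -- the drift: locally Lipschitz in `(x, u)` uniformly in `a`, continuous in `a`, linear growth
    (hfLip : ∀ K : Set (EuclideanSpace ℝ (Fin n) × EuclideanSpace ℝ (Fin m)),
      IsCompact K → K ⊆ univ ×ˢ U →
      ∃ L : NNReal, ∀ b ∈ A, LipschitzOnWith L (fun p => f p.1 p.2 b) K)
    (hfcont : ∀ x, ∀ z ∈ U, ContinuousOn (f x z) A)
    (hfgrowth : ∃ M : ℝ, 0 < M ∧ ∀ x, ∀ z ∈ U, ∀ b ∈ A, ‖f x z b‖ ≤ M * (1 + ‖(x, z)‖))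
    -- bounded inputs give bounded states
    (hbound : Impulsive.BoundedInputBoundedState T U A f g)
    -- the input
    (x₀ : EuclideanSpace ℝ (Fin n))
    (u : ℝ → EuclideanSpace ℝ (Fin m)) (hu : Impulsive.MemL1I T {0} U u)
    (hubdd : ∃ Ω₀ : Set (EuclideanSpace ℝ (Fin m)), IsOpen Ω₀ ∧ IsConnected Ω₀ ∧
      Bornology.IsBounded Ω₀ ∧ Ω₀ ⊆ U ∧ Impulsive.MemL1I T {0} (closure Ω₀) u)
    (a : ℝ → EuclideanSpace ℝ (Fin l)) (ha : Impulsive.MemL1I T ∅ A a) :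
    ∃ ξ : ℝ → EuclideanSpace ℝ (Fin n),
      Impulsive.MemL1I T {0} univ ξ ∧
      Impulsive.IsGeneralizedSolution T {0} U f g x₀ u a (fun t => (ξ t, u t)) ∧
      ∀ w : ℝ → EuclideanSpace ℝ (Fin n) × EuclideanSpace ℝ (Fin m),
        Impulsive.IsGeneralizedSolution T {0} U f g x₀ u a w →
        Impulsive.EqI T {0} w (fun t => (ξ t, u t)) := by
  obtain ⟨Ω, -, -, rfl⟩ := hU
  have hf : Impulsive.IsRegularDrift (closure Ω) A f :=
    ⟨isClosed_closure, hA.isClosed, hfLip, hfcont, hfgrowth⟩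
  obtain ⟨P, Ψ, h⟩ := Impulsive.exists_isRectification hg hcomplete hcomm
  obtain ⟨Ω₀, hΩ₀, hΩ₀c, hΩ₀b, hΩ₀U, huΩ₀⟩ := hubdd
  exact Impulsive.exists_unique_generalizedSolution hT.le hf h ha hbound hΩ₀ hΩ₀c hΩ₀b hΩ₀U hu
    huΩ₀
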